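/- **Setting.** Let $d\ge 1$, $N\ge 0$. Let $\mathcal X\subset\mathbb R^d$ be closed and convex with $r\mathbb B\subseteq\mathcal X\subseteq R\,\mathbb B$, $0<r\le R$, where $\mathbb B$ is the closed unit ball. For every slot $t=1,2,\dots$ let $f_t:\mathbb R^d\to\mathbb R$ and $g_t=(g_t^1,\dots,g_t^N):\mathbb R^d\to\mathbb R^N$ be (entrywise) convex and differentiable at the points of $\mathcal X$, with $|f_t|\le F$, $\|\nabla f_t\|\le G$ and $\|\nabla g^n_t\|\le G$ on $\mathcal X$. Assume that there are $\eta>0$, $\gamma_0\in(0,1)$ and $\tilde x\in(1-\gamma_0)\mathcal X$ with $g^n_t(\tilde x)\le-\eta$ for all $t,n$. Let $x_t^*$ be a minimizer of $f_t$ over $\{x\in\mathcal X: g_t(x)\le 0\}$, and $V(x^*_{1:T})=\sum_{t=2}^T\|x_t^*-x_{t-1}^*\|$. **Algorithm (BanSaP).** For a horizon $T$ take parameters $\alpha=\mu>0$, $\delta>0$, $\gamma=\delta/r<1$, an initial point $\hat x_1\in(1-\gamma)\mathcal X$, $\lambda_1=0\in\mathbb R^N$, and independent $u_1,u_2,\dots$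 uniformly distributed on the unit sphere of $\mathbb R^d$. With projection $P_{(1-\gamma)\mathcal X}$ and positive part $[\cdot]^+$ taken entrywise, $$\hat x_{t+1}=P_{(1-\gamma)\mathcal X}\Big(\hat x_t-\alpha\big(\hat\nabla f_t(\hat x_t)+\textstyle\sum_n\lambda_t^n\nabla g_t^n(\hat x_t)\big)\Big),\qquad \lambda^n_{t+1}=\big[\lambda^n_t+\mu\big(g^n_t(\hat x_t)+\langle\nabla g^n_t(\hat x_t),\hat x_{t+1}-\hat x_t\rangle\big)\big]^+ .$$ With one-point feedback ($M=1$) the action is $x_{1,t}=\hat x_t+\delta u_t$ and $\hat\nabla f_t(\hat x_t)=\frac d\delta f_t(\hat x_t+\delta u_t)u_t$. With two-point feedback ($M=2$) the actions are $x_{1,t}=\hat x_t+\delta u_t$, $x_{2,t}=\hat x_t-\delta u_t$ and $\hat\nabla f_t(\hat x_t)=\frac d{2\delta}\big(f_t(\hat x_t+\delta u_t)-f_t(\hat x_t-\delta u_t)\big)u_t$. Put $$\mathrm{Reg}^d_T=\frac1M\sum_{t=1}^T\sum_{m=1}^M\mathbb E[f_t(x_{m,t})]-\sum_{t=1}^Tf_t(x_t^*),\qquad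 \mathrm{Fit}^d_T=\Big\|\Big[\frac1M\sum_{t=1}^T\sum_{m=1}^Mg_t(x_{m,t})\Big]^+\Big\| .$$ **Claim.** Let $\rho\in[0,1)$ and suppose $V(x^*_{1:T})=o(T^\rho)$ as $T\to\infty$. (1) One-point feedback: let $a_1T^{\frac34(\rho-1)}\le\alpha=\mu\le a_2T^{\frac34(\rho-1)}$ and $b_1T^{\frac14(\rho-1)}\le\delta\le b_2T^{\frac14(\rho-1)}$ for all large $T$, with $a_1,b_1>0$. Then there is a non-random $C$ such that $\mathrm{Reg}^d_T\le C\,T^{\frac14(\rho+3)}$ for all large $T$; almost surely $\mathrm{Fit}^d_T\le C\,T^{\frac14(\rho+3)}$ for all large $T$; and $\mathbb E[\mathrm{Fit}^d_T]\le C\,T^{\frac14(\rho+3)}$ for all large $T$. (2) Two-point feedback: let $a_1T^{\frac12(\rho-1)}\le\alpha=\mu\le a_2T^{\frac12(\rho-1)}$ and $0<\delta\le b_2T^{\frac12(\rho-1)}$ for all large $T$, with $a_1>0$. Then there is a non-random $C$ such that, for all large $T$, $\mathrm{Reg}^d_T\le C\,T^{\frac12(\rho+1)}$ and, almost surely, $\mathrm{Fit}^d_T\le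 C\,T^{\frac12(\rho+1)}$. The expectations exist (the losses $f_t(x_{m,t})$, $t\le T$, in both cases and $\mathrm{Fit}^d_T$ in (1) are integrable for all large $T$). In both cases $C$ depends only on $d,N,F,G,\eta,r,R,\rho$ and the constants $a_1,a_2,b_1,b_2$. The runs for different $T$ may be dependent in any way. -/

import Mathlib

open Filter Topology MeasureTheory ProbabilityTheory Asymptotics
open scoped Pointwise Gradient

/-- Euclidean space `ℝⁿ` with its Euclidean norm. -/
abbrev Vec (n : ℕ) : Type := EuclideanSpace ℝ (Fin n)

/-- The unit sphere of `ℝᵈ`. -/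
abbrev UnitSphere (d : ℕ) : Type := Metric.sphere (0 : Vec d) 1

/-- The uniform distribution on the unit sphere: normalized surface measure
(for `d = 1` the two points `1` and `-1` get mass `1/2` each). -/
noncomputable def uniformSphere (d : ℕ) : Measure (UnitSphere d) :=
  ((volume : Measure (Vec d)).toSphere Set.univ)⁻¹ • (volume : Measure (Vec d)).toSphere

/-- `p` minimizes `‖p - y‖` over `p ∈ K`. -/
def IsProjection {d : ℕ} (K : Set (Vec d)) (y p : Vec d) : Prop :=
  p ∈ K ∧ ∀ x ∈ K, ‖p - y‖ ≤ ‖x - y‖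

/-- The Euclidean projection `P_K(y)` (meaningful for `K` nonempty, closed and convex). -/
noncomputable def proj {d : ℕ} (K : Set (Vec d)) (y : Vec d) : Vec d :=
  Classical.epsilon (IsProjection K y)

theorem proj_spec {d : ℕ} {K : Set (Vec d)} (hne : K.Nonempty) (hcl : IsClosed K) (y : Vec d) :
    IsProjection K y (proj K y) := by
  obtain ⟨p, hp, h⟩ := hcl.exists_infDist_eq_dist hne y
  refine Classical.epsilon_spec (p := IsProjection K y) ⟨p, hp, fun x hx => ?_⟩
  have := Metric.infDist_le_dist_of_mem (x := y) hx
  rw [h, dist_comm y p, dist_comm y x, dist_eq_norm, dist_eq_norm] at this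
  exact this

/-- The data of the problem: the action set `X`, the losses `f t` and the constraint functions
`g t` with entries `g t x n`. Slots are numbered from `0`, so that a horizon `T`
consists of the slots `0, …, T - 1`. -/
structure OnlineProblem (d N : ℕ) where
  X : Set (Vec d)
  f : ℕ → Vec d → ℝ
  g : ℕ → Vec d → Vec N

namespace OnlineProblem

variable {d N : ℕ}

/-- The standing assumptions, with constants `F, G, η, r, R`. -/
structure Regular (Q : OnlineProblem d N) (F G η r R : ℝ) : Prop where
  convex_X : Convex ℝ Q.X
  closed_X : IsClosed Q.X
  convex_f : ∀ t, ConvexOn ℝ Set.univ (Q.f t)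
  convex_g : ∀ t n, ConvexOn ℝ Set.univ (fun x => Q.g t x n)
  bound_f : ∀ t, ∀ x ∈ Q.X, |Q.f t x| ≤ F
  diff_f : ∀ t, ∀ x ∈ Q.X, DifferentiableAt ℝ (Q.f t) x
  grad_f : ∀ t, ∀ x ∈ Q.X, ‖∇ (Q.f t) x‖ ≤ G
  diff_g : ∀ t n, ∀ x ∈ Q.X, DifferentiableAt ℝ (fun y => Q.g t y n) x
  grad_g : ∀ t n, ∀ x ∈ Q.X, ‖∇ (fun y => Q.g t y n) x‖ ≤ G
  eta_pos : 0 < η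
  slater : ∃ γ₀ ∈ Set.Ioo (0 : ℝ) 1, ∃ z ∈ (1 - γ₀) • Q.X, ∀ t n, Q.g t z n ≤ -η
  r_pos : 0 < r
  r_le_R : r ≤ R
  ball_subset : Metric.closedBall 0 r ⊆ Q.X
  subset_ball : Q.X ⊆ Metric.closedBall 0 R

/-- `xs t` solves `min f t x` over `x ∈ X` subject to `g t x ≤ 0`, in every slot `t`. -/
def IsSlotMinimizer (Q : OnlineProblem d N) (xs : ℕ → Vec d) : Prop :=
  ∀ t, (xs t ∈ Q.X ∧ ∀ n, Q.g t (xs t) n ≤ 0) ∧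
    ∀ x ∈ Q.X, (∀ n, Q.g t x n ≤ 0) → Q.f t (xs t) ≤ Q.f t x

end OnlineProblem

/-- The accumulated variation of the first `T` terms of `xs`. -/
noncomputable def variation {d : ℕ} (xs : ℕ → Vec d) (T : ℕ) : ℝ :=
  ∑ t ∈ Finset.range (T - 1), ‖xs (t + 1) - xs t‖

/-- One-point or two-point feedback. -/
inductive Feedback
  | one
  | two

namespace Feedback

/-- The number of points queried per slot. -/
def M : Feedback → ℕ
  | one => 1
  | two => 2

/-- The points that are played when the iterate is `x` and the random direction is `v`. -/
noncomputable def query {d : ℕ} :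
    (fb : Feedback) → (δ : ℝ) → (x : Vec d) → (v : UnitSphere d) → Fin fb.M → Vec d
  | one, δ, x, v => ![x + δ • (v : Vec d)]
  | two, δ, x, v => ![x + δ • (v : Vec d), x - δ • (v : Vec d)]

/-- The gradient estimate of the loss `f` at the iterate `x`, from function values at
the played points only. -/
noncomputable def gradEst {d : ℕ} :
    (fb : Feedback) → (f : Vec d → ℝ) → (δ : ℝ) → (x : Vec d) → (v : UnitSphere d) → Vec d
  | one, f, δ, x, v => ((d : ℝ) / δ * f (x + δ • (v : Vec d))) • (v : Vec d)
  | two, f, δ, x, v =>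
      ((d : ℝ) / (2 * δ) * (f (x + δ • (v : Vec d)) - f (x - δ • (v : Vec d)))) • (v : Vec d)

end Feedback

/-- Step sizes `α` (primal), `μ` (dual), perturbation `δ`, shrinkage `γ`. -/
structure BanSaPParams where
  α : ℝ
  μ : ℝ
  δ : ℝ
  γ : ℝ

namespace OnlineProblem

variable {d N : ℕ}

/-- The estimated gradient of the slot-`t` Lagrangian with respect to `x` at `(x, l)`. -/
noncomputable def lagrangianGradEst (Q : OnlineProblem d N) (fb : Feedback) (δ : ℝ) (t : ℕ)
    (x : Vec d) (l : Vec N) (v : UnitSphere d) : Vec d :=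
  fb.gradEst (Q.f t) δ x v + ∑ n, l n • ∇ (fun y => Q.g t y n) x

/-- The primal update: a projected step onto `(1 - γ) X`. -/
noncomputable def primalStep (Q : OnlineProblem d N) (fb : Feedback) (p : BanSaPParams) (t : ℕ)
    (x : Vec d) (l : Vec N) (v : UnitSphere d) : Vec d :=
  proj ((1 - p.γ) • Q.X) (x - p.α • Q.lagrangianGradEst fb p.δ t x l v)

/-- The dual update, where `x` is the current and `x'` the next primal iterate. -/
noncomputable def dualStep (Q : OnlineProblem d N) (p : BanSaPParams) (t : ℕ)
    (x x' : Vec d) (l : Vec N) : Vec N :=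
  WithLp.toLp 2 fun n =>
    max (l n + p.μ * (Q.g t x n + inner ℝ (∇ (fun y => Q.g t y n) x) (x' - x))) 0

/-- The pair (primal iterate, dual iterate) at the beginning of slot `t`, along the
directions `v 0, v 1, …`, started at `(x₁, 0)`. -/
noncomputable def iterate (Q : OnlineProblem d N) (fb : Feedback) (p : BanSaPParams)
    (x₁ : Vec d) (v : ℕ → UnitSphere d) : ℕ → Vec d × Vec N
  | 0 => (x₁, 0)
  | t + 1 =>
    let s := Q.iterate fb p x₁ v t
    let x' := Q.primalStep fb p t s.1 s.2 (v t)
    (x', Q.dualStep p t s.1 x' s.2)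

/-- The `m`-th action played in slot `t`. -/
noncomputable def action (Q : OnlineProblem d N) (fb : Feedback) (p : BanSaPParams)
    (x₁ : Vec d) (v : ℕ → UnitSphere d) (t : ℕ) (m : Fin fb.M) : Vec d :=
  fb.query p.δ (Q.iterate fb p x₁ v t).1 (v t) m

/-- The dynamic regret over the horizon `T` against the sequence `xs`; the expectation is over
the random directions `u t : Ω → UnitSphere d`. -/
noncomputable def regret (Q : OnlineProblem d N) (fb : Feedback) (p : BanSaPParams)
    (x₁ : Vec d) {Ω : Type*} [MeasurableSpace Ω] (P : Measure Ω) (u : ℕ → Ω → UnitSphere d)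
    (xs : ℕ → Vec d) (T : ℕ) : ℝ :=
  1 / (fb.M : ℝ) * ∑ t ∈ Finset.range T, ∑ m,
      ∫ ω, Q.f t (Q.action fb p x₁ (fun s => u s ω) t m) ∂P
    - ∑ t ∈ Finset.range T, Q.f t (xs t)

/-- The dynamic fit over the horizon `T` along the directions `v`. -/
noncomputable def fit (Q : OnlineProblem d N) (fb : Feedback) (p : BanSaPParams)
    (x₁ : Vec d) (v : ℕ → UnitSphere d) (T : ℕ) : ℝ :=
  ‖(WithLp.toLp 2 fun n =>
      max (1 / (fb.M : ℝ) * ∑ t ∈ Finset.range T, ∑ m, Q.g t (Q.action fb p x₁ v t m) n) 0 :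
    Vec N)‖

end OnlineProblem

/-- `u 0, u 1, …` are independent and uniformly distributed on the unit sphere. -/
def IsUniformIID {d : ℕ} {Ω : Type*} [MeasurableSpace Ω] (P : Measure Ω)
    (u : ℕ → Ω → UnitSphere d) : Prop :=
  iIndepFun u P ∧ ∀ t, HasLaw (u t) (uniformSphere d) P

/-- The parameters with equal primal and dual step sizes `a`, perturbation `δ`
and shrinkage `δ / r`. -/
noncomputable def coupledParams (r a δ : ℝ) : BanSaPParams :=
  { α := a, μ := a, δ := δ, γ := δ / r }

/-!
Averaged over the sphere, the one-point and two-point gradient estimators are approximate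
subgradients: a convex function compares with its mirror image through the query point, and
`E[⟪v, w⟫ v] = w / d` fixes the scale. A step of the algorithm then decreases the potential
`(‖z - x‖ ^ 2 + ‖λ‖ ^ 2) / 2`, up to second-order terms, by the step size times the linearized
Lagrangian gap at `z`. Summing along the comparator, shrunk into the feasible region of the
iterates, telescopes to the regret bound. With `z` a Slater point the gap is at least `η ∑ n, λ n`
minus a constant, so the potential drifts down wherever `λ` is large. The fit is controlled by the
dual iterate, hence by this potential: under two-point feedback the gradient estimates are bounded
and the drift bounds the potential surely; under one-point feedback they are of size `d F / δ`, and
the drift bounds the exponential moments of the potential, so that the exceptional probabilities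
are summable over the horizons and contribute a bounded amount to the expected fit.
-/

/-! ### Convex functions -/

section Convexity

variable {E : Type*} [NormedAddCommGroup E] [InnerProductSpace ℝ E]

theorem inner_gradient_sub_le_of_convexOn [CompleteSpace E] {s : Set E} {f : E → ℝ}
    (hf : ConvexOn ℝ s f) {x y : E} (hx : x ∈ s) (hy : y ∈ s) (hfx : DifferentiableAt ℝ f x) :
    inner ℝ (∇ f x) (y - x) ≤ f y - f x := by
  have hderiv : HasDerivAt (fun c : ℝ => f (AffineMap.lineMap x y c)) (inner ℝ (∇ f x) (y - x))
      0 := by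
    rw [inner_gradient_left]
    have hfx' : HasFDerivAt f (fderiv ℝ f x) (AffineMap.lineMap x y (0 : ℝ)) := by
      simpa using hfx.hasFDerivAt
    exact hfx'.comp_hasDerivAt (0 : ℝ) AffineMap.hasDerivAt_lineMap
  have hslope := (hf.comp_affineMap (AffineMap.lineMap x y)).le_slope_of_hasDerivAt
    (by simpa using hx) (by simpa using hy) one_pos hderiv
  simpa [slope_def_field] using hslope

theorem abs_inner_le_mul_norm {u : E} {G : ℝ} (hu : ‖u‖ ≤ G) (w : E) :
    |inner ℝ u w| ≤ G * ‖w‖ :=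
  (abs_real_inner_le_norm u w).trans (by gcongr)

theorem sub_le_mul_norm_sub_of_convexOn [CompleteSpace E] {s : Set E} {f : E → ℝ}
    (hf : ConvexOn ℝ s f) {x y : E} (hx : x ∈ s) (hy : y ∈ s) (hfx : DifferentiableAt ℝ f x)
    {G : ℝ} (hG : ‖∇ f x‖ ≤ G) : f x - f y ≤ G * ‖x - y‖ := by
  have hgrad := inner_gradient_sub_le_of_convexOn hf hx hy hfx
  have habs := abs_inner_le_mul_norm hG (y - x)
  rw [norm_sub_rev y x] at habs
  linarith [neg_abs_le (inner ℝ (∇ f x) (y - x))]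

theorem sub_le_mul_sub_of_convexOn {V : Type*} [AddCommGroup V] [Module ℝ V] {s : Set V}
    {f : V → ℝ} (hf : ConvexOn ℝ s f) {p w : V} {c : ℝ} (hc : 0 ≤ c) (hback : p - c • w ∈ s)
    (hforw : p + w ∈ s) : f p - f (p - c • w) ≤ c * (f (p + w) - f p) := by
  have hcomb : (1 + c)⁻¹ • (p - c • w) + (c * (1 + c)⁻¹) • (p + w) = p := by
    match_scalars <;> field_simp
    ring
  have hconv := hf.2 hback hforw (by positivity : 0 ≤ (1 + c)⁻¹)
    (by positivity : 0 ≤ c * (1 + c)⁻¹) (by field_simp)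
  rw [hcomb, smul_eq_mul, smul_eq_mul] at hconv
  have hscaled : (1 + c) * f p ≤ f (p - c • w) + c * f (p + w) := by
    calc (1 + c) * f p
        ≤ (1 + c) * ((1 + c)⁻¹ * f (p - c • w) + c * (1 + c)⁻¹ * f (p + w)) := by gcongr
      _ = _ := by field_simp
  linarith

theorem reflection_span_singleton_orthogonal_apply (w v : E) :
    (Submodule.span ℝ {w})ᗮ.reflection v = v - (2 * (inner ℝ v w / ‖w‖ ^ 2)) • w := by
  rw [Submodule.reflection_orthogonal_apply, Submodule.reflection_singleton_apply,
    real_inner_comm, RCLike.ofReal_real_eq_id, id]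
  module

theorem inner_reflection_span_singleton_orthogonal (w v : E) :
    inner ℝ ((Submodule.span ℝ {w})ᗮ.reflection v) w = -inner ℝ v w := by
  have h := ((Submodule.span ℝ {w})ᗮ.reflection).inner_map_map v w
  rw [Submodule.reflection_orthogonalComplement_singleton_eq_neg, inner_neg_right] at h
  linarith

/-- Moving from `x + δ v` to its mirror image is a step in the direction `-w`, so convexity compares
the decrease of `f` along it with the increase of `f` along `w`. -/
theorem sub_reflection_mul_inner_le_of_inner_nonneg {f : E → ℝ} (hf : ConvexOn ℝ Set.univ f)
    {x w v : E} {δ D : ℝ} (hδ : 0 ≤ δ) (hD : f (x + δ • v + w) - f (x + δ • v) ≤ D)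
    (hvw : 0 ≤ inner ℝ v w) :
    (f (x + δ • v) - f (x + δ • (Submodule.span ℝ {w})ᗮ.reflection v)) * inner ℝ v w ≤
      2 * δ * D * (inner ℝ v w ^ 2 / ‖w‖ ^ 2) := by
  set c := 2 * δ * (inner ℝ v w / ‖w‖ ^ 2) with hc
  have hc0 : 0 ≤ c := by positivity
  have hrefl : x + δ • v - c • w = x + δ • (Submodule.span ℝ {w})ᗮ.reflection v := by
    rw [reflection_span_singleton_orthogonal_apply, hc]
    module
  have hback := sub_le_mul_sub_of_convexOn hf (p := x + δ • v) hc0 (Set.mem_univ _)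
    (Set.mem_univ (x + δ • v + w))
  rw [hrefl] at hback
  calc _ ≤ c * D * inner ℝ v w := by
        gcongr
        exact hback.trans (by gcongr)
    _ = _ := by rw [hc]; ring

theorem sub_reflection_mul_inner_le {f : E → ℝ} (hf : ConvexOn ℝ Set.univ f) {x w : E} {δ D : ℝ}
    (hδ : 0 ≤ δ) (hD : ∀ v : E, ‖v‖ = 1 → f (x + δ • v + w) - f (x + δ • v) ≤ D) {v : E}
    (hv : ‖v‖ = 1) :
    (f (x + δ • v) - f (x + δ • (Submodule.span ℝ {w})ᗮ.reflection v)) * inner ℝ v w ≤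
      2 * δ * D * (inner ℝ v w ^ 2 / ‖w‖ ^ 2) := by
  rcases le_total 0 (inner ℝ v w) with hvw | hvw
  · exact sub_reflection_mul_inner_le_of_inner_nonneg hf hδ (hD v hv) hvw
  · set v' := (Submodule.span ℝ {w})ᗮ.reflection v with hv'
    have hinner : inner ℝ v' w = -inner ℝ v w := inner_reflection_span_singleton_orthogonal w v
    have hmirror := sub_reflection_mul_inner_le_of_inner_nonneg hf hδ
      (hD v' (by rw [hv', LinearIsometryEquiv.norm_map, hv])) (by linarith)
    rw [hinner, hv', Submodule.reflection_reflection, neg_sq] at hmirror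
    linarith

end Convexity

/-! ### The uniform distribution on the sphere -/

section Sphere

variable {d : ℕ}

instance isProbabilityMeasure_uniformSphere [NeZero d] :
    IsProbabilityMeasure (uniformSphere d) where
  measure_univ := by
    have huniv : (volume : Measure (Vec d)).toSphere Set.univ ≠ 0 := by
      rw [Ne, Measure.measure_univ_eq_zero]
      exact Measure.toSphere_ne_zero _
    rw [uniformSphere, Measure.smul_apply, smul_eq_mul]
    exact ENNReal.inv_mul_cancel huniv (measure_ne_top _ _)

theorem nonempty_unitSphere [NeZero d] : Nonempty (UnitSphere d) :=
  nonempty_of_isProbabilityMeasure (uniformSphere d)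

theorem integrable_uniformSphere [NeZero d] {φ : UnitSphere d → ℝ} (hφ : Continuous φ) :
    Integrable φ (uniformSphere d) :=
  hφ.integrable_of_hasCompactSupport (HasCompactSupport.of_compactSpace φ)

/-- The action of a linear isometry on the unit sphere. -/
noncomputable def sphereMap (A : Vec d ≃ₗᵢ[ℝ] Vec d) (v : UnitSphere d) : UnitSphere d :=
  ⟨A v, by simp⟩

theorem continuous_sphereMap (A : Vec d ≃ₗᵢ[ℝ] Vec d) : Continuous (sphereMap A) :=
  (A.continuous.comp continuous_subtype_val).subtype_mk _

theorem Ioo_smul_image_sphereMap_preimage (A : Vec d ≃ₗᵢ[ℝ] Vec d) (s : Set (UnitSphere d)) :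
    Set.Ioo (0 : ℝ) 1 • ((↑) '' (sphereMap A ⁻¹' s) : Set (Vec d)) =
      A ⁻¹' (Set.Ioo (0 : ℝ) 1 • ((↑) '' s : Set (Vec d))) := by
  ext x
  simp only [Set.mem_smul, Set.mem_image, Set.mem_preimage]
  constructor
  · rintro ⟨c, hc, _, ⟨v, hv, rfl⟩, rfl⟩
    exact ⟨c, hc, _, ⟨_, hv, rfl⟩, by simp [sphereMap]⟩
  · rintro ⟨c, hc, _, ⟨v, hv, rfl⟩, h⟩
    refine ⟨c, hc, _, ⟨sphereMap A.symm v, ?_, rfl⟩, A.injective (by simp [sphereMap, h])⟩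
    simpa [sphereMap] using hv

theorem measurePreserving_sphereMap (A : Vec d ≃ₗᵢ[ℝ] Vec d) :
    MeasurePreserving (sphereMap A) (uniformSphere d) (uniformSphere d) := by
  have hA := (continuous_sphereMap A).measurable
  refine ⟨hA, ?_⟩
  ext s hs
  rw [Measure.map_apply hA hs, uniformSphere, Measure.smul_apply, Measure.smul_apply,
    Measure.toSphere_apply' _ (hA hs), Measure.toSphere_apply' _ hs,
    Ioo_smul_image_sphereMap_preimage,
    ← A.coe_toMeasurableEquiv,
    A.measurePreserving.measure_preimage_equiv (f := A.toMeasurableEquiv)]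

theorem integral_comp_sphereMap (A : Vec d ≃ₗᵢ[ℝ] Vec d) {φ : UnitSphere d → ℝ}
    (hφ : Continuous φ) :
    ∫ v, φ (sphereMap A v) ∂uniformSphere d = ∫ v, φ v ∂uniformSphere d := by
  rw [← (measurePreserving_sphereMap A).map_eq, integral_map
    (continuous_sphereMap A).aemeasurable hφ.aestronglyMeasurable,
    (measurePreserving_sphereMap A).map_eq]

theorem integral_inner_sq_uniformSphere_congr {e e' : Vec d} (h : ‖e‖ = ‖e'‖) :
    ∫ v : UnitSphere d, inner ℝ (v : Vec d) e ^ 2 ∂uniformSphere d =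
      ∫ v : UnitSphere d, inner ℝ (v : Vec d) e' ^ 2 ∂uniformSphere d := by
  set A : Vec d ≃ₗᵢ[ℝ] Vec d := (Submodule.span ℝ {e - e'})ᗮ.reflection
  have hAe : A e = e' := Submodule.reflection_sub h
  rw [← integral_comp_sphereMap A (φ := fun v => inner ℝ (v : Vec d) e' ^ 2) (by fun_prop)]
  simp only [sphereMap, ← hAe, LinearIsometryEquiv.inner_map_map]

theorem integral_inner_sq_uniformSphere [NeZero d] (e : Vec d) :
    ∫ v : UnitSphere d, inner ℝ (v : Vec d) e ^ 2 ∂uniformSphere d = ‖e‖ ^ 2 / d := by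
  set b := EuclideanSpace.basisFun (Fin d) ℝ
  have hrotate (i : Fin d) : ∫ v : UnitSphere d, inner ℝ (v : Vec d) (‖e‖ • b i) ^ 2
      ∂uniformSphere d = ∫ v : UnitSphere d, inner ℝ (v : Vec d) e ^ 2 ∂uniformSphere d :=
    integral_inner_sq_uniformSphere_congr (by simp [norm_smul])
  have hpyth (v : UnitSphere d) : ∑ i, inner ℝ (v : Vec d) (‖e‖ • b i) ^ 2 = ‖e‖ ^ 2 := by
    simp only [inner_smul_right, mul_pow, ← Finset.mul_sum, b.sum_sq_inner_left]
    simp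
  have hsum : ∑ i, ∫ v : UnitSphere d, inner ℝ (v : Vec d) (‖e‖ • b i) ^ 2 ∂uniformSphere d =
      ‖e‖ ^ 2 := by
    rw [← integral_finsetSum _ (fun i _ => integrable_uniformSphere (by fun_prop))]
    simp [hpyth]
  simp only [hrotate, Finset.sum_const, Finset.card_univ, Fintype.card_fin, nsmul_eq_mul] at hsum
  have hd : (d : ℝ) ≠ 0 := NeZero.ne _
  rw [eq_div_iff hd, mul_comm, hsum]

/-- The one-point estimator `(d / δ) f (x + δ v) v` is on average an approximate subgradient at `x`:
pairing `v` with its mirror image across the hyperplane `wᗮ` turns the integrand into a difference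
of values of `f`. -/
theorem integral_uniformSphere_mul_inner_le [NeZero d] {f : Vec d → ℝ}
    (hf : ConvexOn ℝ Set.univ f) {x w : Vec d} {δ D : ℝ} (hδ : 0 < δ)
    (hD : ∀ v : Vec d, ‖v‖ = 1 → f (x + δ • v + w) - f (x + δ • v) ≤ D) :
    ∫ v : UnitSphere d, (d : ℝ) / δ * f (x + δ • (v : Vec d)) * inner ℝ (v : Vec d) w
      ∂uniformSphere d ≤ D := by
  have hd : (0 : ℝ) < d := Nat.cast_pos.2 (NeZero.pos d)
  obtain ⟨v₀⟩ : Nonempty (UnitSphere d) := nonempty_unitSphere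
  rcases eq_or_ne w 0 with rfl | hw
  · simpa using hD v₀ (by simp)
  have hfc : Continuous f := continuousOn_univ.1 (hf.continuousOn isOpen_univ)
  set A : Vec d ≃ₗᵢ[ℝ] Vec d := (Submodule.span ℝ {w})ᗮ.reflection with hA
  set φ : UnitSphere d → ℝ := fun v => f (x + δ • (v : Vec d)) * inner ℝ (v : Vec d) w with hφ
  have hφc : Continuous φ := by fun_prop
  have hφA : Continuous (φ ∘ sphereMap A) := hφc.comp (continuous_sphereMap A)
  have hpair (v : UnitSphere d) : φ v + φ (sphereMap A v) ≤
      2 * δ * D * (inner ℝ (v : Vec d) w ^ 2 / ‖w‖ ^ 2) := by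
    have := sub_reflection_mul_inner_le hf hδ.le hD (v := v) (by simp)
    simp only [hφ, sphereMap, hA, inner_reflection_span_singleton_orthogonal]
    linarith
  have hφint : ∫ v, φ v ∂uniformSphere d ≤ δ * D / d := by
    have htwice : 2 * ∫ v, φ v ∂uniformSphere d ≤ 2 * (δ * D / d) := calc
      2 * ∫ v, φ v ∂uniformSphere d = ∫ v, (φ v + φ (sphereMap A v)) ∂uniformSphere d := by
        rw [integral_add (integrable_uniformSphere hφc) (g := fun v => φ (sphereMap A v))
          (integrable_uniformSphere hφA),
          integral_comp_sphereMap A hφc, two_mul]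
      _ ≤ ∫ v : UnitSphere d, 2 * δ * D * (inner ℝ (v : Vec d) w ^ 2 / ‖w‖ ^ 2)
          ∂uniformSphere d :=
        integral_mono (integrable_uniformSphere (hφc.add hφA))
          (integrable_uniformSphere (by fun_prop)) hpair
      _ = 2 * (δ * D / d) := by
        rw [integral_const_mul, integral_div, integral_inner_sq_uniformSphere]
        field_simp
    linarith
  calc _ = d / δ * ∫ v, φ v ∂uniformSphere d := by
        simp only [← integral_const_mul, hφ, mul_assoc]
    _ ≤ d / δ * (δ * D / d) := by gcongr
    _ = D := by field_simp

end Sphere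

/-! ### Projections -/

section Projection

variable {d : ℕ} {K : Set (Vec d)} (hne : K.Nonempty) (hcl : IsClosed K)
include hne hcl

theorem proj_mem (y : Vec d) : proj K y ∈ K := (proj_spec hne hcl y).1

theorem proj_eq_self {x : Vec d} (hx : x ∈ K) : proj K x = x :=
  sub_eq_zero.1 (norm_le_zero_iff.1 (by simpa using (proj_spec hne hcl x).2 x hx))

variable (hc : Convex ℝ K)
include hc

theorem inner_sub_proj_nonpos (y : Vec d) {z : Vec d} (hz : z ∈ K) :
    inner ℝ (y - proj K y) (z - proj K y) ≤ 0 := by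
  obtain ⟨hmem, hmin⟩ := proj_spec hne hcl y
  have : Nonempty K := hne.to_subtype
  refine (norm_eq_iInf_iff_real_inner_le_zero hc hmem).1 ?_ z hz
  refine le_antisymm (le_ciInf fun w => ?_) ?_
  · rw [norm_sub_rev, norm_sub_rev y]
    exact hmin w w.2
  · exact ciInf_le ⟨0, by rintro _ ⟨w, rfl⟩; exact norm_nonneg _⟩ (⟨proj K y, hmem⟩ : K)

theorem norm_proj_sub_proj_sq_le (x y : Vec d) :
    ‖proj K x - proj K y‖ ^ 2 ≤ inner ℝ (x - y) (proj K x - proj K y) := by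
  have hx := inner_sub_proj_nonpos hne hcl hc x (proj_mem hne hcl y)
  have hy := inner_sub_proj_nonpos hne hcl hc y (proj_mem hne hcl x)
  rw [← real_inner_self_eq_norm_sq]
  simp only [inner_sub_left, inner_sub_right, real_inner_comm] at hx hy ⊢
  linarith

theorem norm_proj_sub_proj_le (x y : Vec d) : ‖proj K x - proj K y‖ ≤ ‖x - y‖ := by
  have hsq := norm_proj_sub_proj_sq_le hne hcl hc x y
  have hcs := real_inner_le_norm (x - y) (proj K x - proj K y)
  by_contra! h
  nlinarith [norm_nonneg (x - y), norm_nonneg (proj K x - proj K y)]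

theorem continuous_proj : Continuous (proj K) :=
  (LipschitzWith.of_dist_le_mul (K := 1) fun x y => by
    simpa only [NNReal.coe_one, one_mul, dist_eq_norm] using
      norm_proj_sub_proj_le hne hcl hc x y).continuous

theorem norm_proj_sub_sub_le {x : Vec d} (hx : x ∈ K) (w : Vec d) :
    ‖proj K (x - w) - x‖ ≤ ‖w‖ := by
  simpa [proj_eq_self hne hcl hx] using norm_proj_sub_proj_le hne hcl hc (x - w) x

theorem norm_sub_proj_sub_add_sq_le (x u w : Vec d) {z : Vec d} (hz : z ∈ K) :
    ‖z - proj K (x - (u + w))‖ ^ 2 ≤ ‖z - x‖ ^ 2 + 2 * inner ℝ u (z - x) + ‖u‖ ^ 2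
      + 2 * inner ℝ w (z - proj K (x - (u + w))) := by
  have hproj := inner_sub_proj_nonpos hne hcl hc (x - (u + w)) hz
  set p := proj K (x - (u + w))
  have hsq : 0 ≤ ‖p - x + u‖ ^ 2 := by positivity
  simp only [← real_inner_self_eq_norm_sq, inner_sub_left, inner_sub_right, inner_add_left,
    inner_add_right] at hproj hsq ⊢
  linarith [real_inner_comm x z, real_inner_comm p z, real_inner_comm x p, real_inner_comm u p,
    real_inner_comm u x]

end Projection
/-! ### Consequences of the standing assumptions -/

namespace OnlineProblem

variable {d N : ℕ} {Q : OnlineProblem d N} {F G η r R δ : ℝ}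

namespace Regular

variable (h : Q.Regular F G η r R)
include h

theorem zero_mem : (0 : Vec d) ∈ Q.X := h.ball_subset (by simp [h.r_pos.le])

theorem F_nonneg : 0 ≤ F := (abs_nonneg _).trans (h.bound_f 0 0 h.zero_mem)

theorem G_nonneg : 0 ≤ G := (norm_nonneg _).trans (h.grad_f 0 0 h.zero_mem)

theorem R_pos : 0 < R := h.r_pos.trans_le h.r_le_R

theorem continuous_f (t : ℕ) : Continuous (Q.f t) :=
  continuousOn_univ.1 ((h.convex_f t).continuousOn isOpen_univ)

theorem continuous_g (t : ℕ) (n : Fin N) : Continuous fun x => Q.g t x n :=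
  continuousOn_univ.1 ((h.convex_g t n).continuousOn isOpen_univ)

theorem norm_le {x : Vec d} (hx : x ∈ Q.X) : ‖x‖ ≤ R := by simpa using h.subset_ball hx

theorem norm_sub_le_of_mem {x y : Vec d} (hx : x ∈ Q.X) (hy : y ∈ Q.X) : ‖x - y‖ ≤ 2 * R := by
  linarith [norm_sub_le x y, h.norm_le hx, h.norm_le hy]

theorem smul_subset_smul {a b : ℝ} (ha : 0 ≤ a) (hab : a ≤ b) : a • Q.X ⊆ b • Q.X := by
  rintro _ ⟨x, hx, rfl⟩
  rcases (ha.trans hab).eq_or_lt with hb | hb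
  · obtain rfl : a = b := le_antisymm hab (hb ▸ ha)
    exact ⟨x, hx, rfl⟩
  · refine ⟨(a / b) • x, h.convex_X.smul_mem_of_zero_mem h.zero_mem hx
      ⟨by positivity, (div_le_one hb).2 hab⟩, ?_⟩
    simp only [smul_smul, mul_div_cancel₀ a hb.ne']

theorem shrink_subset (hδ : 0 ≤ δ) (hδr : δ ≤ r) : (1 - δ / r) • Q.X ⊆ Q.X := by
  simpa using h.smul_subset_smul (sub_nonneg.2 ((div_le_one h.r_pos).2 hδr))
    (sub_le_self 1 (div_nonneg hδ h.r_pos.le))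

theorem add_smul_mem (hδ : 0 ≤ δ) (hδr : δ ≤ r) {x v : Vec d} (hx : x ∈ (1 - δ / r) • Q.X)
    (hv : ‖v‖ = 1) : x + δ • v ∈ Q.X := by
  obtain ⟨y, hy, rfl⟩ := hx
  have hball : r • v ∈ Q.X := h.ball_subset (by simp [norm_smul, hv, abs_of_pos h.r_pos])
  have hcomb := h.convex_X hy hball (sub_nonneg.2 ((div_le_one h.r_pos).2 hδr))
    (div_nonneg hδ h.r_pos.le) (by ring)
  rwa [smul_smul, div_mul_cancel₀ _ h.r_pos.ne'] at hcomb

theorem sub_smul_mem (hδ : 0 ≤ δ) (hδr : δ ≤ r) {x v : Vec d} (hx : x ∈ (1 - δ / r) • Q.X)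
    (hv : ‖v‖ = 1) : x - δ • v ∈ Q.X := by
  simpa [sub_eq_add_neg] using h.add_smul_mem hδ hδr hx (v := -v) (by simpa using hv)

theorem isClosed_smul (a : ℝ) : IsClosed (a • Q.X) := by
  have hcompact : IsCompact Q.X :=
    (isCompact_closedBall (0 : Vec d) R).of_isClosed_subset h.closed_X h.subset_ball
  exact (hcompact.smul a).isClosed

theorem nonempty_smul (a : ℝ) : (a • Q.X).Nonempty := ⟨_, Set.smul_mem_smul_set h.zero_mem⟩

theorem f_sub_le (t : ℕ) {x : Vec d} (hx : x ∈ Q.X) (y : Vec d) :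
    Q.f t x - Q.f t y ≤ G * ‖x - y‖ :=
  sub_le_mul_norm_sub_of_convexOn (h.convex_f t) (Set.mem_univ _) (Set.mem_univ _)
    (h.diff_f t x hx) (h.grad_f t x hx)

theorem g_sub_le (t : ℕ) (n : Fin N) {x : Vec d} (hx : x ∈ Q.X) (y : Vec d) :
    Q.g t x n - Q.g t y n ≤ G * ‖x - y‖ :=
  sub_le_mul_norm_sub_of_convexOn (h.convex_g t n) (Set.mem_univ _) (Set.mem_univ _)
    (h.diff_g t n x hx) (h.grad_g t n x hx)

theorem abs_inner_grad_g_le (t : ℕ) (n : Fin N) {x y z : Vec d} (hx : x ∈ Q.X) (hy : y ∈ Q.X)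
    (hz : z ∈ Q.X) : |inner ℝ (∇ (fun y => Q.g t y n) x) (z - y)| ≤ 2 * R * G := by
  have hdiam := mul_le_mul_of_nonneg_left (h.norm_sub_le_of_mem hz hy) h.G_nonneg
  linarith [abs_inner_le_mul_norm (h.grad_g t n x hx) (z - y)]

theorem g_le (t : ℕ) (n : Fin N) {x : Vec d} (hx : x ∈ Q.X) : Q.g t x n ≤ 2 * R * G - η := by
  obtain ⟨γ, hγ, z, hz, hzg⟩ := h.slater
  have hzX : z ∈ Q.X := by
    simpa using h.smul_subset_smul (sub_nonneg.2 hγ.2.le) (sub_le_self 1 hγ.1.le) hz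
  have hdiam := mul_le_mul_of_nonneg_left (h.norm_sub_le_of_mem hx hzX) h.G_nonneg
  linarith [h.g_sub_le t n hx z, hzg t n]

theorem mul_norm_shrink_sub_le (hδ : 0 ≤ δ) {y : Vec d} (hy : y ∈ Q.X) :
    G * ‖(1 - δ / r) • y - y‖ ≤ G * (δ / r) * R := by
  have hγ : 0 ≤ δ / r := div_nonneg hδ h.r_pos.le
  rw [show (1 - δ / r) • y - y = -((δ / r) • y) by module, norm_neg, norm_smul,
    Real.norm_eq_abs, abs_of_nonneg hγ, ← mul_assoc]
  exact mul_le_mul_of_nonneg_left (h.norm_le hy) (mul_nonneg h.G_nonneg hγ)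

theorem f_shrink_le (hδ : 0 ≤ δ) (hδr : δ ≤ r) (t : ℕ) {y : Vec d} (hy : y ∈ Q.X) :
    Q.f t ((1 - δ / r) • y) ≤ Q.f t y + G * (δ / r) * R := by
  linarith [h.f_sub_le t (h.shrink_subset hδ hδr (Set.smul_mem_smul_set hy)) y,
    h.mul_norm_shrink_sub_le hδ hy]

theorem g_shrink_le (hδ : 0 ≤ δ) (hδr : δ ≤ r) (t : ℕ) (n : Fin N) {y : Vec d} (hy : y ∈ Q.X) :
    Q.g t ((1 - δ / r) • y) n ≤ Q.g t y n + G * (δ / r) * R := by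
  linarith [h.g_sub_le t n (h.shrink_subset hδ hδr (Set.smul_mem_smul_set hy)) y,
    h.mul_norm_shrink_sub_le hδ hy]

theorem sum_norm_sub_le_variation {xs : ℕ → Vec d} (hxs : ∀ t, xs t ∈ Q.X) (T : ℕ) :
    ∑ t ∈ Finset.range T, ‖xs (t + 1) - xs t‖ ≤ variation xs T + 2 * R := by
  cases T with
  | zero => simp [variation, h.R_pos.le]
  | succ T =>
    rw [Finset.sum_range_succ]
    exact add_le_add_right (h.norm_sub_le_of_mem (hxs (T + 1)) (hxs T)) _

theorem sum_norm_shrink_sub_le (hδ : 0 ≤ δ) (hδr : δ ≤ r) {xs : ℕ → Vec d}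
    (hxs : ∀ t, xs t ∈ Q.X) (T : ℕ) :
    ∑ t ∈ Finset.range T, ‖(1 - δ / r) • xs (t + 1) - (1 - δ / r) • xs t‖ ≤
      variation xs T + 2 * R := by
  refine (Finset.sum_le_sum fun t _ => ?_).trans (h.sum_norm_sub_le_variation hxs T)
  have hγ₁ : δ / r ≤ 1 := (div_le_one h.r_pos).2 hδr
  have hγ : 0 ≤ δ / r := div_nonneg hδ h.r_pos.le
  rw [← smul_sub, norm_smul, Real.norm_eq_abs, abs_of_nonneg (sub_nonneg.2 hγ₁)]
  exact mul_le_of_le_one_left (norm_nonneg _) (by linarith)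

end Regular

/-! ### The one-step inequality -/

/-- The linearization at `x` of the `n`-th constraint, evaluated at `z`, with the value at `x`
truncated from below at `-k`. The constraints are only bounded from above on `X`; the truncation
keeps their contribution to the dual iterates bounded and can only enlarge these iterates. -/
noncomputable def truncLin (Q : OnlineProblem d N) (k : ℝ) (t : ℕ) (x z : Vec d) (n : Fin N) : ℝ :=
  max (Q.g t x n) (-k) + inner ℝ (∇ (fun y => Q.g t y n) x) (z - x)

/-- The update of the pair (primal iterate, dual iterate) in slot `t` in direction `v`. -/
noncomputable def update (Q : OnlineProblem d N) (fb : Feedback) (p : BanSaPParams) (t : ℕ)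
    (s : Vec d × Vec N) (v : UnitSphere d) : Vec d × Vec N :=
  (Q.primalStep fb p t s.1 s.2 v, Q.dualStep p t s.1 (Q.primalStep fb p t s.1 s.2 v) s.2)

theorem iterate_succ (fb : Feedback) (p : BanSaPParams) (x₁ : Vec d)
    (v : ℕ → UnitSphere d) (t : ℕ) :
    Q.iterate fb p x₁ v (t + 1) = Q.update fb p t (Q.iterate fb p x₁ v t) (v t) := rfl

/-- The states that a run can visit: the primal iterate is in the shrunken set and the dual iterate
is nonnegative. -/
def Feasible (Q : OnlineProblem d N) (γ : ℝ) (s : Vec d × Vec N) : Prop :=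
  s.1 ∈ (1 - γ) • Q.X ∧ ∀ n, 0 ≤ s.2 n

/-- The Lyapunov function of the analysis: half the squared distance of a state to `(z, 0)`. -/
noncomputable def potential (z : Vec d) (s : Vec d × Vec N) : ℝ :=
  (‖s.2‖ ^ 2 + ‖z - s.1‖ ^ 2) / 2

/-- The constant of the second-order term in the one-step inequality, for gradient estimates of
norm at most `B`. -/
noncomputable def stepConst (N : ℕ) (G η R B : ℝ) : ℝ := (B ^ 2 + N * (4 * R * G + η) ^ 2) / 2

theorem stepConst_nonneg (N : ℕ) (G η R B : ℝ) : 0 ≤ stepConst N G η R B := by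
  unfold stepConst
  positivity

theorem potential_nonneg (z : Vec d) (s : Vec d × Vec N) : 0 ≤ potential z s := by
  unfold potential
  positivity

theorem continuous_potential (z : Vec d) :
    Continuous fun s : Vec d × Vec N => potential z s := by
  unfold potential
  fun_prop

theorem potential_le_potential_add {z z' : Vec d} {s : Vec d × Vec N} {D : ℝ}
    (hz : ‖z - s.1‖ ≤ D) (hz' : ‖z' - s.1‖ ≤ D) :
    potential z' s ≤ potential z s + D * ‖z' - z‖ := by
  have htri : ‖z' - s.1‖ ≤ ‖z' - z‖ + ‖z - s.1‖ := norm_sub_le_norm_sub_add_norm_sub z' z s.1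
  have hdiff : (‖z' - s.1‖ - ‖z - s.1‖) * (‖z' - s.1‖ + ‖z - s.1‖) ≤ ‖z' - z‖ * (D + D) := by
    gcongr
    linarith
  unfold potential
  linarith

theorem max_add_zero_sq_le {l c C : ℝ} (hc : |c| ≤ C) :
    max (l + c) 0 ^ 2 ≤ l ^ 2 + 2 * (l * c) + C ^ 2 := by
  have hmax : max (l + c) 0 ^ 2 ≤ (l + c) ^ 2 := by
    rcases max_cases (l + c) 0 with ⟨h, _⟩ | ⟨h, _⟩ <;> rw [h]
    simpa using sq_nonneg (l + c)
  linarith [sq_le_sq' (neg_le_of_abs_le hc) (le_of_abs_le hc)]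

theorem sum_mul_truncLin_add_inner (k : ℝ) (t : ℕ) (x y z : Vec d) (l : Vec N) :
    ∑ n, l n * Q.truncLin k t x y n
      + inner ℝ (∑ n, l n • ∇ (fun y => Q.g t y n) x) (z - y) =
    ∑ n, l n * Q.truncLin k t x z n := by
  rw [sum_inner, ← Finset.sum_add_distrib]
  refine Finset.sum_congr rfl fun n _ => ?_
  simp only [truncLin, real_inner_smul_left, inner_sub_right]
  ring

namespace Regular

variable (h : Q.Regular F G η r R)
include h

theorem abs_truncLin_le (t : ℕ) {x z : Vec d} (hx : x ∈ Q.X) (hz : z ∈ Q.X) (n : Fin N) :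
    |Q.truncLin (2 * R * G + η) t x z n| ≤ 4 * R * G + η := by
  have hRG : 0 ≤ R * G := mul_nonneg h.R_pos.le h.G_nonneg
  have hmax : |max (Q.g t x n) (-(2 * R * G + η))| ≤ 2 * R * G + η :=
    abs_le.2 ⟨le_max_right _ _, max_le (by linarith [h.g_le t n hx, h.eta_pos])
      (by linarith [h.eta_pos])⟩
  unfold truncLin
  linarith [abs_add_le (max (Q.g t x n) (-(2 * R * G + η)))
    (inner ℝ (∇ (fun y => Q.g t y n) x) (z - x)), h.abs_inner_grad_g_le t n hx hx hz]

theorem truncLin_le (t : ℕ) {x z : Vec d} (hx : x ∈ Q.X) (hz : z ∈ Q.X) (n : Fin N) :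
    Q.truncLin (2 * R * G + η) t x z n ≤ max (Q.g t z n) (-η) := by
  have hconv := inner_gradient_sub_le_of_convexOn (h.convex_g t n) (Set.mem_univ x)
    (Set.mem_univ z) (h.diff_g t n x hx)
  have habs := le_of_abs_le (h.abs_inner_grad_g_le t n hx hx hz)
  unfold truncLin
  rw [max_add]
  exact max_le_max (by linarith) (by linarith)

theorem norm_dualStep_sq_le {p : BanSaPParams} (hμ : 0 ≤ p.μ) (t : ℕ) {x x' : Vec d}
    (hx : x ∈ Q.X) (hx' : x' ∈ Q.X) (l : Vec N) :
    ‖Q.dualStep p t x x' l‖ ^ 2 ≤ ‖l‖ ^ 2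
      + 2 * p.μ * ∑ n, l n * Q.truncLin (2 * R * G + η) t x x' n
      + N * (p.μ * (4 * R * G + η)) ^ 2 := by
  have hentry (n : Fin N) : Q.dualStep p t x x' l n ^ 2 ≤
      l n ^ 2 + 2 * p.μ * (l n * Q.truncLin (2 * R * G + η) t x x' n)
        + (p.μ * (4 * R * G + η)) ^ 2 := by
    have htrunc : Q.dualStep p t x x' l n ≤
        max (l n + p.μ * Q.truncLin (2 * R * G + η) t x x' n) 0 := by
      simp only [dualStep, truncLin]
      gcongr
      exact le_max_left _ _
    have habs : |p.μ * Q.truncLin (2 * R * G + η) t x x' n| ≤ p.μ * (4 * R * G + η) := by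
      rw [abs_mul, abs_of_nonneg hμ]
      gcongr
      exact h.abs_truncLin_le t hx hx' n
    calc Q.dualStep p t x x' l n ^ 2
        ≤ max (l n + p.μ * Q.truncLin (2 * R * G + η) t x x' n) 0 ^ 2 :=
          pow_le_pow_left₀ (le_max_right _ _) htrunc 2
      _ ≤ _ := max_add_zero_sq_le habs
      _ = _ := by ring
  simp only [EuclideanSpace.norm_sq_eq, Real.norm_eq_abs, sq_abs]
  calc _ ≤ _ := Finset.sum_le_sum fun n _ => hentry n
    _ = _ := by simp [Finset.sum_add_distrib, ← Finset.mul_sum]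

theorem primalStep_mem (fb : Feedback) (p : BanSaPParams) (t : ℕ) (x : Vec d) (l : Vec N)
    (v : UnitSphere d) : Q.primalStep fb p t x l v ∈ (1 - p.γ) • Q.X :=
  proj_mem (h.nonempty_smul _) (h.isClosed_smul _) _

theorem norm_sub_primalStep_sq_le (fb : Feedback) (p : BanSaPParams) (t : ℕ) (x : Vec d)
    (l : Vec N) (v : UnitSphere d) {z : Vec d} (hz : z ∈ (1 - p.γ) • Q.X) :
    ‖z - Q.primalStep fb p t x l v‖ ^ 2 ≤ ‖z - x‖ ^ 2
      + 2 * (p.α * inner ℝ (fb.gradEst (Q.f t) p.δ x v) (z - x))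
      + p.α ^ 2 * ‖fb.gradEst (Q.f t) p.δ x v‖ ^ 2
      + 2 * (p.α * inner ℝ (∑ n, l n • ∇ (fun y => Q.g t y n) x)
        (z - Q.primalStep fb p t x l v)) := by
  have hstep := norm_sub_proj_sub_add_sq_le (h.nonempty_smul _) (h.isClosed_smul _)
    (h.convex_X.smul _) x (p.α • fb.gradEst (Q.f t) p.δ x v)
    (p.α • ∑ n, l n • ∇ (fun y => Q.g t y n) x) hz
  rw [← smul_add, norm_smul, mul_pow, Real.norm_eq_abs, sq_abs, real_inner_smul_left,
    real_inner_smul_left] at hstep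
  exact hstep

theorem potential_update_le (fb : Feedback) {a B c : ℝ} (ha : 0 ≤ a) (hδ : 0 ≤ δ)
    (hδr : δ ≤ r) (t : ℕ) {s : Vec d × Vec N} (hs : Q.Feasible (δ / r) s) (v : UnitSphere d)
    (hB : ‖fb.gradEst (Q.f t) δ s.1 v‖ ≤ B) {z : Vec d} (hz : z ∈ (1 - δ / r) • Q.X)
    (hzc : ∀ n, Q.g t z n ≤ c) (hc : -η ≤ c) :
    potential z (Q.update fb (coupledParams r a δ) t s v) ≤ potential z s
      + a * inner ℝ (fb.gradEst (Q.f t) δ s.1 v) (z - s.1)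
      + a * c * ∑ n, s.2 n + a ^ 2 * stepConst N G η R B := by
  obtain ⟨x, l⟩ := s
  have hxX := h.shrink_subset hδ hδr hs.1
  set x' := Q.primalStep fb (coupledParams r a δ) t x l v with hx'
  have hx'X : x' ∈ Q.X := h.shrink_subset hδ hδr (h.primalStep_mem fb (coupledParams r a δ) t x l v)
  have hprimal := h.norm_sub_primalStep_sq_le fb (coupledParams r a δ) t x l v hz
  have hdual := h.norm_dualStep_sq_le (p := coupledParams r a δ) ha t hxX hx'X l
  rw [← hx'] at hprimal
  have hlin := sum_mul_truncLin_add_inner (Q := Q) (2 * R * G + η) t x x' z l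
  have hcomp : ∑ n, l n * Q.truncLin (2 * R * G + η) t x z n ≤ c * ∑ n, l n := by
    rw [mul_comm c, Finset.sum_mul]
    refine Finset.sum_le_sum fun n _ => mul_le_mul_of_nonneg_left ?_ (hs.2 n)
    exact (h.truncLin_le t hxX (h.shrink_subset hδ hδr hz) n).trans (max_le (hzc n) hc)
  have hquad : a ^ 2 * ‖fb.gradEst (Q.f t) δ x v‖ ^ 2 ≤ a ^ 2 * B ^ 2 := by gcongr
  simp only [coupledParams] at hprimal hdual hx'
  simp only [potential, update, stepConst, coupledParams, ← hx']
  linarith [mul_le_mul_of_nonneg_left (hlin.trans_le hcomp) ha]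

theorem feasible_iterate (fb : Feedback) (p : BanSaPParams) {x₁ : Vec d}
    (hx : x₁ ∈ (1 - p.γ) • Q.X) (v : ℕ → UnitSphere d) (t : ℕ) :
    Q.Feasible p.γ (Q.iterate fb p x₁ v t) := by
  cases t with
  | zero => exact ⟨hx, fun n => le_rfl⟩
  | succ t => exact ⟨h.primalStep_mem fb p t _ _ _, fun n => le_max_right _ _⟩

end Regular

end OnlineProblem
/-! ### The gradient estimates -/

namespace Feedback

variable {d : ℕ}

theorem continuous_gradEst (fb : Feedback) {f : Vec d → ℝ} (hf : Continuous f) (δ : ℝ) :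
    Continuous fun q : Vec d × UnitSphere d => fb.gradEst f δ q.1 q.2 := by
  cases fb <;> (simp only [gradEst]; fun_prop)

theorem continuous_query (fb : Feedback) (δ : ℝ) (m : Fin fb.M) :
    Continuous fun q : Vec d × UnitSphere d => fb.query δ q.1 q.2 m := by
  cases fb with
  | one =>
    change Fin 1 at m
    fin_cases m
    change Continuous fun q : Vec d × UnitSphere d => q.1 + δ • (q.2 : Vec d)
    fun_prop
  | two =>
    change Fin 2 at m
    fin_cases m
    · change Continuous fun q : Vec d × UnitSphere d => q.1 + δ • (q.2 : Vec d)
      fun_prop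
    · change Continuous fun q : Vec d × UnitSphere d => q.1 - δ • (q.2 : Vec d)
      fun_prop

theorem query_eq_add_or_eq_sub (fb : Feedback) (δ : ℝ) (x : Vec d) (v : UnitSphere d)
    (m : Fin fb.M) :
    fb.query δ x v m = x + δ • (v : Vec d) ∨ fb.query δ x v m = x - δ • (v : Vec d) := by
  cases fb with
  | one =>
    change Fin 1 at m
    fin_cases m
    exact .inl rfl
  | two =>
    change Fin 2 at m
    fin_cases m
    · exact .inl rfl
    · exact .inr rfl

theorem M_pos (fb : Feedback) : 0 < fb.M := by cases fb <;> simp [M]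

/-- The antipodal map shows that both estimators have the same mean. -/
theorem integral_inner_gradEst [NeZero d] (fb : Feedback) {f : Vec d → ℝ} (hf : Continuous f)
    (δ : ℝ) (x w : Vec d) :
    ∫ v, inner ℝ (fb.gradEst f δ x v) w ∂uniformSphere d =
      ∫ v : UnitSphere d, (d : ℝ) / δ * f (x + δ • (v : Vec d)) * inner ℝ (v : Vec d) w
        ∂uniformSphere d := by
  cases fb with
  | one => simp only [gradEst, real_inner_smul_left]
  | two =>
    set φ : UnitSphere d → ℝ := fun v =>
      (d : ℝ) / δ * f (x + δ • (v : Vec d)) * inner ℝ (v : Vec d) w with hφ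
    have hφc : Continuous φ := by fun_prop
    set A : Vec d ≃ₗᵢ[ℝ] Vec d := LinearIsometryEquiv.neg ℝ with hA
    have hφA : Continuous fun v => φ (sphereMap A v) := hφc.comp (continuous_sphereMap A)
    have havg (v : UnitSphere d) : inner ℝ (two.gradEst f δ x v) w =
        1 / 2 * (φ v + φ (sphereMap A v)) := by
      simp only [gradEst, real_inner_smul_left, hφ, sphereMap, hA,
        LinearIsometryEquiv.coe_neg, smul_neg, inner_neg_left, ← sub_eq_add_neg]
      ring
    simp only [havg]
    rw [integral_const_mul, integral_add (integrable_uniformSphere hφc)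
      (integrable_uniformSphere hφA), integral_comp_sphereMap A hφc]
    ring

end Feedback

namespace OnlineProblem.Regular

variable {d N : ℕ} {Q : OnlineProblem d N} {F G η r R δ : ℝ} (h : Q.Regular F G η r R)
include h

theorem norm_gradEst_one_le (hδ : 0 < δ) (hδr : δ ≤ r) (t : ℕ) {x : Vec d}
    (hx : x ∈ (1 - δ / r) • Q.X) (v : UnitSphere d) :
    ‖Feedback.one.gradEst (Q.f t) δ x v‖ ≤ d * F / δ := by
  have hf := h.bound_f t _ (h.add_smul_mem hδ.le hδr hx (v := v) (by simp))
  calc ‖Feedback.one.gradEst (Q.f t) δ x v‖ = d / δ * |Q.f t (x + δ • (v : Vec d))| := by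
        simp [Feedback.gradEst, norm_smul, abs_of_pos hδ]
    _ ≤ d / δ * F := by gcongr
    _ = d * F / δ := by ring

theorem norm_gradEst_two_le (hδ : 0 < δ) (hδr : δ ≤ r) (t : ℕ) {x : Vec d}
    (hx : x ∈ (1 - δ / r) • Q.X) (v : UnitSphere d) :
    ‖Feedback.two.gradEst (Q.f t) δ x v‖ ≤ d * G := by
  have hadd := h.f_sub_le t (h.add_smul_mem hδ.le hδr hx (v := v) (by simp)) (x - δ • (v : Vec d))
  have hsub := h.f_sub_le t (h.sub_smul_mem hδ.le hδr hx (v := v) (by simp)) (x + δ • (v : Vec d))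
  have hdist : ‖x + δ • (v : Vec d) - (x - δ • (v : Vec d))‖ = 2 * δ := by
    rw [show x + δ • (v : Vec d) - (x - δ • (v : Vec d)) = (2 * δ) • (v : Vec d) by module]
    simp [norm_smul, abs_of_pos hδ]
  rw [norm_sub_rev, hdist] at hsub
  rw [hdist] at hadd
  calc ‖Feedback.two.gradEst (Q.f t) δ x v‖
      = d / (2 * δ) * |Q.f t (x + δ • (v : Vec d)) - Q.f t (x - δ • (v : Vec d))| := by
        simp [Feedback.gradEst, norm_smul, abs_of_pos hδ]
    _ ≤ d / (2 * δ) * (G * (2 * δ)) := by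
        gcongr
        exact abs_le.2 ⟨by linarith, by linarith⟩
    _ = d * G := by field_simp

theorem integral_inner_gradEst_le [NeZero d] (fb : Feedback) (hδ : 0 < δ) (hδr : δ ≤ r) (t : ℕ)
    {x z : Vec d} (hx : x ∈ (1 - δ / r) • Q.X) (hz : z ∈ (1 - δ / r) • Q.X) :
    ∫ v, inner ℝ (fb.gradEst (Q.f t) δ x v) (z - x) ∂uniformSphere d ≤
      Q.f t z - Q.f t x + 2 * δ * G := by
  rw [fb.integral_inner_gradEst (h.continuous_f t)]
  refine integral_uniformSphere_mul_inner_le (h.convex_f t) hδ fun v hv => ?_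
  have hzv := h.f_sub_le t (h.add_smul_mem hδ.le hδr hz hv) z
  have hxv := h.f_sub_le t (h.shrink_subset hδ.le hδr hx) (x + δ • v)
  rw [add_sub_cancel_left, norm_smul, hv, Real.norm_eq_abs, abs_of_pos hδ] at hzv
  rw [sub_add_cancel_left, norm_neg, norm_smul, hv, Real.norm_eq_abs, abs_of_pos hδ] at hxv
  rw [show x + δ • v + (z - x) = z + δ • v by abel]
  linarith

end OnlineProblem.Regular

/-! ### Measurability -/

theorem measurable_gradient {d : ℕ} (f : Vec d → ℝ) : Measurable (∇ f) :=
  (InnerProductSpace.toDual ℝ (Vec d)).symm.continuous.measurable.comp (measurable_fderiv ℝ f)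

namespace OnlineProblem

variable {d N : ℕ} {Q : OnlineProblem d N} {F G η r R : ℝ}

theorem iterate_congr (fb : Feedback) (p : BanSaPParams) (x₁ : Vec d) {v w : ℕ → UnitSphere d}
    {t : ℕ} (hvw : ∀ s < t, v s = w s) : Q.iterate fb p x₁ v t = Q.iterate fb p x₁ w t := by
  induction t with
  | zero => rfl
  | succ t ih =>
    rw [iterate_succ, iterate_succ, ih fun s hs => hvw s (by lia), hvw t (by lia)]

namespace Regular

variable (h : Q.Regular F G η r R)
include h

theorem measurable_primalStep (fb : Feedback) (p : BanSaPParams) (t : ℕ) :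
    Measurable fun q : (Vec d × Vec N) × UnitSphere d => Q.primalStep fb p t q.1.1 q.1.2 q.2 := by
  have hproj := (continuous_proj (h.nonempty_smul (1 - p.γ)) (h.isClosed_smul _)
    (h.convex_X.smul _)).measurable
  have hgrad := (fb.continuous_gradEst (h.continuous_f t) p.δ).measurable
  have hlagrangian : Measurable fun q : (Vec d × Vec N) × UnitSphere d =>
      Q.lagrangianGradEst fb p.δ t q.1.1 q.1.2 q.2 := by
    refine (hgrad.comp (measurable_fst.fst.prodMk measurable_snd)).add
      (Finset.measurable_sum _ fun n _ => ?_)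
    have hl : Measurable fun l : Vec N => l n := by fun_prop
    exact (hl.comp measurable_fst.snd).smul ((measurable_gradient _).comp measurable_fst.fst)
  exact hproj.comp (measurable_fst.fst.sub (hlagrangian.const_smul p.α))

theorem measurable_update (fb : Feedback) (p : BanSaPParams) (t : ℕ) :
    Measurable fun q : (Vec d × Vec N) × UnitSphere d => Q.update fb p t q.1 q.2 := by
  have hprimal := h.measurable_primalStep fb p t
  refine hprimal.prodMk ((WithLp.measurable_toLp 2 _).comp (measurable_pi_iff.2 fun n => ?_))
  have hl : Measurable fun l : Vec N => l n := by fun_prop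
  refine Measurable.max ((hl.comp measurable_fst.snd).add (Measurable.const_mul ?_ _))
    measurable_const
  exact ((h.continuous_g t n).measurable.comp measurable_fst.fst).add
    (((measurable_gradient _).comp measurable_fst.fst).inner (hprimal.sub measurable_fst.fst))

theorem measurable_inner_gradEst (fb : Feedback) (δ : ℝ) (y : Vec d) (t : ℕ) :
    Measurable fun q : (Vec d × Vec N) × UnitSphere d =>
      inner ℝ (fb.gradEst (Q.f t) δ q.1.1 q.2) (y - q.1.1) :=
  ((fb.continuous_gradEst (h.continuous_f t) δ).measurable.comp
    (measurable_fst.fst.prodMk measurable_snd)).inner (measurable_const.sub measurable_fst.fst)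

theorem measurable_iterate (fb : Feedback) (p : BanSaPParams) (x₁ : Vec d) (t : ℕ) :
    Measurable fun v => Q.iterate fb p x₁ v t := by
  induction t with
  | zero => exact measurable_const (a := (x₁, (0 : Vec N)))
  | succ t ih =>
    have hpair : Measurable fun v : ℕ → UnitSphere d => (Q.iterate fb p x₁ v t, v t) :=
      ih.prodMk (measurable_pi_apply t)
    have hcomp := (h.measurable_update fb p t).comp hpair
    have hsucc : (fun v => Q.iterate fb p x₁ v (t + 1)) =
        (fun q : (Vec d × Vec N) × UnitSphere d => Q.update fb p t q.1 q.2) ∘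
          fun v => (Q.iterate fb p x₁ v t, v t) := by
      ext1 v
      rw [iterate_succ, Function.comp_apply]
    rw [hsucc]
    exact hcomp

theorem measurable_action (fb : Feedback) (p : BanSaPParams) (x₁ : Vec d) (t : ℕ) (m : Fin fb.M) :
    Measurable fun v => Q.action fb p x₁ v t m :=
  (fb.continuous_query p.δ m).measurable.comp
    ((h.measurable_iterate fb p x₁ t).fst.prodMk (measurable_pi_apply t))

theorem measurable_fit (fb : Feedback) (p : BanSaPParams) (x₁ : Vec d) (T : ℕ) :
    Measurable fun v => Q.fit fb p x₁ v T := by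
  refine ((WithLp.measurable_toLp 2 _).comp (measurable_pi_iff.2 fun n => ?_)).norm
  refine Measurable.max (Measurable.const_mul ?_ _) measurable_const
  refine Finset.measurable_sum _ fun t _ => Finset.measurable_sum _ fun m _ => ?_
  exact (h.continuous_g t n).measurable.comp (h.measurable_action fb p x₁ t m)

end Regular

end OnlineProblem

/-! ### Sequences of independent uniform directions -/

section SphereSeq

variable {d : ℕ}

/-- The law of a sequence of independent uniform directions. -/
noncomputable def sphereSeq (d : ℕ) : Measure (ℕ → UnitSphere d) :=
  Measure.infinitePi fun _ => uniformSphere d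

instance isProbabilityMeasure_sphereSeq [NeZero d] : IsProbabilityMeasure (sphereSeq d) :=
  inferInstanceAs (IsProbabilityMeasure (Measure.infinitePi fun _ => uniformSphere d))

theorem IsUniformIID.hasLaw_sphereSeq {Ω : Type*} [MeasurableSpace Ω] {P : Measure Ω}
    {u : ℕ → Ω → UnitSphere d} (hu : IsUniformIID P u) :
    HasLaw (fun ω s => u s ω) (sphereSeq d) P :=
  hu.1.hasLaw_infinitePi hu.2 (aemeasurable_pi_iff.2 fun t => (hu.2 t).aemeasurable)

theorem isUniformIID_eval [NeZero d] :
    IsUniformIID (sphereSeq d) (fun t (v : ℕ → UnitSphere d) => v t) :=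
  ⟨iIndepFun_infinitePi (X := fun _ v => v) fun _ => measurable_id, fun t =>
    ⟨(measurable_pi_apply t).aemeasurable, Measure.infinitePi_map_eval _ t⟩⟩

end SphereSeq

namespace OnlineProblem.Regular

variable {d N : ℕ} [NeZero d] {Q : OnlineProblem d N} {F G η r R : ℝ} (h : Q.Regular F G η r R)
  (fb : Feedback) (p : BanSaPParams) {x₁ : Vec d} (t : ℕ)
include h

theorem indepFun_iterate :
    IndepFun (fun v => Q.iterate fb p x₁ v t) (fun v => v t) (sphereSeq d) := by
  obtain ⟨e⟩ : Nonempty (UnitSphere d) := nonempty_unitSphere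
  have hpast := isUniformIID_eval.1.indepFun_finset (Finset.range t) {t} (by simp)
    (measurable_pi_apply (X := fun _ => UnitSphere d))
  set extend : (Finset.range t → UnitSphere d) → ℕ → UnitSphere d :=
    fun w s => if hs : s ∈ Finset.range t then w ⟨s, hs⟩ else e with hextend
  have hextend_meas : Measurable extend := by
    refine measurable_pi_iff.2 fun s => ?_
    by_cases hs : s ∈ Finset.range t
    · simpa only [hextend, hs, dite_true] using measurable_pi_apply _
    · simpa only [hextend, hs, dite_false] using measurable_const
  have hfactor : (fun v => Q.iterate fb p x₁ v t) =
      ((fun v => Q.iterate fb p x₁ v t) ∘ extend) ∘ fun v (s : Finset.range t) => v s := by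
    ext1 v
    exact iterate_congr fb p x₁ fun s hs => by simp [hextend, hs]
  rw [hfactor]
  exact hpast.comp ((h.measurable_iterate fb p x₁ t).comp hextend_meas)
    (measurable_pi_apply (⟨t, Finset.mem_singleton_self t⟩ : ({t} : Finset ℕ)))

theorem map_iterate_prodMk :
    (sphereSeq d).map (fun v => (Q.iterate fb p x₁ v t, v t)) =
      ((sphereSeq d).map fun v => Q.iterate fb p x₁ v t).prod (uniformSphere d) := by
  rw [(h.indepFun_iterate fb p t).map_prod_eq_prod_map_map
    (h.measurable_iterate fb p x₁ t).aemeasurable (measurable_pi_apply t).aemeasurable,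
    (isUniformIID_eval.2 t).map_eq]

/-- The average over the direction of slot `t` may be taken first, since the state at the beginning
of the slot does not depend on it. -/
theorem integral_iterate_le (hx : x₁ ∈ (1 - p.γ) • Q.X) {φ : (Vec d × Vec N) × UnitSphere d → ℝ}
    (hφ : Measurable φ) (hint : Integrable (fun v => φ (Q.iterate fb p x₁ v t, v t)) (sphereSeq d))
    {ψ : Vec d × Vec N → ℝ}
    (hψ : ∀ s, Q.Feasible p.γ s → ∫ v, φ (s, v) ∂uniformSphere d ≤ ψ s)
    (hψint : Integrable (fun v => ψ (Q.iterate fb p x₁ v t)) (sphereSeq d)) :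
    ∫ v, φ (Q.iterate fb p x₁ v t, v t) ∂sphereSeq d ≤
      ∫ v, ψ (Q.iterate fb p x₁ v t) ∂sphereSeq d := by
  have hm := h.measurable_iterate fb p x₁ t
  have hpair : Measurable fun v => (Q.iterate fb p x₁ v t, v t) :=
    hm.prodMk (measurable_pi_apply t)
  have : IsProbabilityMeasure ((sphereSeq d).map fun v => Q.iterate fb p x₁ v t) :=
    Measure.isProbabilityMeasure_map hm.aemeasurable
  have hφint : Integrable φ (((sphereSeq d).map fun v => Q.iterate fb p x₁ v t).prod
      (uniformSphere d)) := by
    rw [← h.map_iterate_prodMk]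
    exact (integrable_map_measure hφ.aestronglyMeasurable hpair.aemeasurable).2 hint
  have hinner : StronglyMeasurable fun s => ∫ v, φ (s, v) ∂uniformSphere d :=
    hφ.stronglyMeasurable.integral_prod_right'
  have hinner_int : Integrable (fun v => ∫ w, φ (Q.iterate fb p x₁ v t, w) ∂uniformSphere d)
      (sphereSeq d) :=
    (integrable_map_measure hinner.aestronglyMeasurable hm.aemeasurable).1 hφint.integral_prod_left
  calc ∫ v, φ (Q.iterate fb p x₁ v t, v t) ∂sphereSeq d
      = ∫ q, φ q ∂((sphereSeq d).map fun v => (Q.iterate fb p x₁ v t, v t)) :=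
        (integral_map hpair.aemeasurable hφ.aestronglyMeasurable).symm
    _ = ∫ s, ∫ v, φ (s, v) ∂uniformSphere d ∂((sphereSeq d).map fun v =>
          Q.iterate fb p x₁ v t) := by
        rw [h.map_iterate_prodMk, integral_prod _ hφint]
    _ = ∫ v, ∫ w, φ (Q.iterate fb p x₁ v t, w) ∂uniformSphere d ∂sphereSeq d :=
        integral_map hm.aemeasurable hinner.aestronglyMeasurable
    _ ≤ _ := integral_mono hinner_int hψint fun v => hψ _ (h.feasible_iterate fb p hx v t)

end OnlineProblem.Regular

/-! ### Bounded runs: expected losses and dual iterates -/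

theorem integral_le_integral_add_const {Ω : Type*} [MeasurableSpace Ω] {P : Measure Ω}
    [IsProbabilityMeasure P] {φ ψ : Ω → ℝ} {c : ℝ} (hφ : Integrable φ P) (hψ : Integrable ψ P)
    (hle : ∀ ω, φ ω ≤ ψ ω + c) : ∫ ω, φ ω ∂P ≤ ∫ ω, ψ ω ∂P + c := by
  calc ∫ ω, φ ω ∂P ≤ ∫ ω, ψ ω + c ∂P := integral_mono hφ (hψ.add (integrable_const c)) hle
    _ = ∫ ω, ψ ω ∂P + c := by simp [integral_add hψ (integrable_const c)]

namespace OnlineProblem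

variable {d N : ℕ}

/-- A run of the algorithm on a regular problem with step size `a`, perturbation `δ` and initial
point `x₁` whose gradient estimates have norm at most `B`, together with a Slater point `z` of the
shrunken set. -/
structure BoundedRun (Q : OnlineProblem d N) (fb : Feedback) (F G η r R a δ B : ℝ)
    (x₁ z : Vec d) : Prop extends Q.Regular F G η r R where
  a_pos : 0 < a
  δ_pos : 0 < δ
  δ_le : δ ≤ r
  B_nonneg : 0 ≤ B
  norm_gradEst_le : ∀ t, ∀ x ∈ (1 - δ / r) • Q.X, ∀ v, ‖fb.gradEst (Q.f t) δ x v‖ ≤ B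
  init_mem : x₁ ∈ (1 - δ / r) • Q.X
  slater_mem : z ∈ (1 - δ / r) • Q.X
  slater_le : ∀ t n, Q.g t z n ≤ -η

namespace BoundedRun

variable {Q : OnlineProblem d N} {fb : Feedback} {F G η r R a δ B : ℝ} {x₁ y z : Vec d}
  (H : Q.BoundedRun fb F G η r R a δ B x₁ z)

local notation "state" => Q.iterate fb (coupledParams r a δ) x₁

section Pathwise

include H

theorem mem_X (hy : y ∈ (1 - δ / r) • Q.X) : y ∈ Q.X := H.shrink_subset H.δ_pos.le H.δ_le hy

theorem feasible (v : ℕ → UnitSphere d) (t : ℕ) : Q.Feasible (δ / r) (state v t) :=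
  H.feasible_iterate fb (coupledParams r a δ) H.init_mem v t

theorem iterate_mem (v : ℕ → UnitSphere d) (t : ℕ) : (state v t).1 ∈ Q.X :=
  H.mem_X (H.feasible v t).1

theorem action_mem (v : ℕ → UnitSphere d) (t : ℕ) (m : Fin fb.M) :
    Q.action fb (coupledParams r a δ) x₁ v t m ∈ Q.X := by
  have hx := (H.feasible v t).1
  change fb.query δ _ _ m ∈ Q.X
  rcases fb.query_eq_add_or_eq_sub δ (state v t).1 (v t) m with hm | hm <;> rw [hm]
  · exact H.add_smul_mem H.δ_pos.le H.δ_le hx (by simp)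
  · exact H.sub_smul_mem H.δ_pos.le H.δ_le hx (by simp)

theorem norm_action_sub_iterate (v : ℕ → UnitSphere d) (t : ℕ) (m : Fin fb.M) :
    ‖Q.action fb (coupledParams r a δ) x₁ v t m - (state v t).1‖ = δ := by
  change ‖fb.query δ _ _ m - _‖ = δ
  rcases fb.query_eq_add_or_eq_sub δ (state v t).1 (v t) m with hm | hm <;> rw [hm]
  · simp [norm_smul, abs_of_pos H.δ_pos]
  · simp [norm_smul, abs_of_pos H.δ_pos]

theorem abs_inner_gradEst_le {x : Vec d} (hx : x ∈ (1 - δ / r) • Q.X)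
    (hy : y ∈ (1 - δ / r) • Q.X) (t : ℕ) (v : UnitSphere d) :
    |inner ℝ (fb.gradEst (Q.f t) δ x v) (y - x)| ≤ 2 * R * B := by
  calc _ ≤ B * ‖y - x‖ := abs_inner_le_mul_norm (H.norm_gradEst_le t x hx v) _
    _ ≤ B * (2 * R) :=
      mul_le_mul_of_nonneg_left (H.norm_sub_le_of_mem (H.mem_X hy) (H.mem_X hx)) H.B_nonneg
    _ = 2 * R * B := by ring

theorem potential_succ_le (hy : y ∈ (1 - δ / r) • Q.X) (v : ℕ → UnitSphere d) (t : ℕ) {c : ℝ}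
    (hyc : ∀ n, Q.g t y n ≤ c) (hc : -η ≤ c) :
    potential y (state v (t + 1)) ≤ potential y (state v t)
      + a * inner ℝ (fb.gradEst (Q.f t) δ (state v t).1 (v t)) (y - (state v t).1)
      + a * c * ∑ n, (state v t).2 n + a ^ 2 * stepConst N G η R B :=
  H.potential_update_le fb H.a_pos.le H.δ_pos.le H.δ_le t (H.feasible v t) (v t)
    (H.norm_gradEst_le t _ (H.feasible v t).1 (v t)) hy hyc hc

theorem potential_init_le (hy : y ∈ Q.X) (v : ℕ → UnitSphere d) :
    potential y (state v 0) ≤ 2 * R ^ 2 := by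
  have hdiam := pow_le_pow_left₀ (norm_nonneg _)
    (H.norm_sub_le_of_mem hy (H.mem_X H.init_mem)) 2
  simp only [potential, iterate, norm_zero]
  linarith

theorem potential_slater_succ_le (v : ℕ → UnitSphere d) (t : ℕ) :
    potential z (state v (t + 1)) ≤ potential z (state v t)
      + (a * (2 * R * B) + a ^ 2 * stepConst N G η R B) := by
  have hstep := H.potential_succ_le H.slater_mem v t (H.slater_le t) le_rfl
  have hinner := mul_le_mul_of_nonneg_left
    (le_of_abs_le (H.abs_inner_gradEst_le (H.feasible v t).1 H.slater_mem t (v t))) H.a_pos.le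
  have hdual : 0 ≤ a * η * ∑ n, (state v t).2 n :=
    mul_nonneg (mul_nonneg H.a_pos.le H.eta_pos.le)
      (Finset.sum_nonneg fun n _ => (H.feasible v t).2 n)
  linarith

theorem potential_slater_le (v : ℕ → UnitSphere d) (t : ℕ) :
    potential z (state v t) ≤
      2 * R ^ 2 + t * (a * (2 * R * B) + a ^ 2 * stepConst N G η R B) := by
  induction t with
  | zero => simpa using H.potential_init_le (H.mem_X H.slater_mem) v
  | succ t ih =>
    push_cast
    linarith [H.potential_slater_succ_le v t]

end Pathwise

section Integrable

variable [NeZero d]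
include H

theorem integrable_f (t : ℕ) : Integrable (fun v => Q.f t (state v t).1) (sphereSeq d) :=
  .of_bound ((H.continuous_f t).measurable.comp
    (H.measurable_iterate fb _ x₁ t).fst).aestronglyMeasurable F
    (ae_of_all _ fun v => H.bound_f t _ (H.iterate_mem v t))

theorem integrable_f_action (t : ℕ) (m : Fin fb.M) :
    Integrable (fun v => Q.f t (Q.action fb (coupledParams r a δ) x₁ v t m)) (sphereSeq d) :=
  .of_bound ((H.continuous_f t).measurable.comp
    (H.measurable_action fb _ x₁ t m)).aestronglyMeasurable F
    (ae_of_all _ fun v => H.bound_f t _ (H.action_mem v t m))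

theorem integrable_potential (hy : y ∈ Q.X) (t : ℕ) :
    Integrable (fun v => potential y (state v t)) (sphereSeq d) := by
  refine .of_bound ((continuous_potential y).measurable.comp
    (H.measurable_iterate fb _ x₁ t)).aestronglyMeasurable
    (2 * R ^ 2 + t * (a * (2 * R * B) + a ^ 2 * stepConst N G η R B) + 2 * R * ‖y - z‖)
    (ae_of_all _ fun v => ?_)
  rw [Real.norm_eq_abs, abs_of_nonneg (potential_nonneg _ _)]
  have hx := H.iterate_mem v t
  linarith [H.potential_slater_le v t, potential_le_potential_add
    (H.norm_sub_le_of_mem (H.mem_X H.slater_mem) hx) (H.norm_sub_le_of_mem hy hx)]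

theorem integrable_sum_dual (t : ℕ) :
    Integrable (fun v => ∑ n, (state v t).2 n) (sphereSeq d) := by
  refine integrable_finsetSum _ fun n _ => ?_
  have hcoord : Continuous fun l : Vec N => l n := by fun_prop
  refine ((H.integrable_potential (H.mem_X H.slater_mem) t).add
    (integrable_const 1)).mono' (hcoord.measurable.comp
    (H.measurable_iterate fb _ x₁ t).snd).aestronglyMeasurable (ae_of_all _ fun v => ?_)
  refine (PiLp.norm_apply_le (state v t).2 n).trans ?_
  simp only [potential, Pi.add_apply]
  linarith [sq_nonneg ‖z - (state v t).1‖, sq_nonneg (‖(state v t).2‖ - 1)]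

theorem integrable_inner_gradEst (hy : y ∈ (1 - δ / r) • Q.X) (t : ℕ) :
    Integrable (fun v => inner ℝ (fb.gradEst (Q.f t) δ (state v t).1 (v t))
      (y - (state v t).1)) (sphereSeq d) :=
  .of_bound ((H.measurable_inner_gradEst fb δ y t).comp
    ((H.measurable_iterate fb _ x₁ t).prodMk (measurable_pi_apply t))).aestronglyMeasurable
    (2 * R * B) (ae_of_all _ fun v => H.abs_inner_gradEst_le (H.feasible v t).1 hy t (v t))

end Integrable

section Expectation

variable [NeZero d]
include H

theorem integral_inner_gradEst_state_le (hy : y ∈ (1 - δ / r) • Q.X) (t : ℕ) :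
    ∫ v, inner ℝ (fb.gradEst (Q.f t) δ (state v t).1 (v t)) (y - (state v t).1) ∂sphereSeq d ≤
      Q.f t y - ∫ v, Q.f t (state v t).1 ∂sphereSeq d + 2 * δ * G := by
  have hf := H.integrable_f t
  have hsub : Integrable (fun v => Q.f t y - Q.f t (state v t).1) (sphereSeq d) :=
    (integrable_const _).sub hf
  refine (H.integral_iterate_le fb (coupledParams r a δ) t H.init_mem
    (H.measurable_inner_gradEst fb δ y t) (H.integrable_inner_gradEst hy t)
    (ψ := fun s => Q.f t y - Q.f t s.1 + 2 * δ * G)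
    (fun s hs => H.integral_inner_gradEst_le fb H.δ_pos H.δ_le t hs.1 hy)
    (hsub.add (integrable_const _))).trans_eq ?_
  rw [integral_add hsub (integrable_const _), integral_sub (integrable_const _) hf]
  simp only [integral_const, probReal_univ, one_smul]

theorem integral_potential_succ_le (hy : y ∈ (1 - δ / r) • Q.X) (t : ℕ) {c : ℝ}
    (hyc : ∀ n, Q.g t y n ≤ c) (hc : -η ≤ c) :
    ∫ v, potential y (state v (t + 1)) ∂sphereSeq d ≤
      ∫ v, potential y (state v t) ∂sphereSeq d
      + a * (Q.f t y - ∫ v, Q.f t (state v t).1 ∂sphereSeq d + 2 * δ * G)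
      + a * c * ∫ v, ∑ n, (state v t).2 n ∂sphereSeq d + a ^ 2 * stepConst N G η R B := by
  have hpot := H.integrable_potential (H.mem_X hy) t
  have hinner := (H.integrable_inner_gradEst hy t).const_mul a
  have hdual := (H.integrable_sum_dual t).const_mul (a * c)
  have hsum : Integrable (fun v => potential y (state v t) +
      a * inner ℝ (fb.gradEst (Q.f t) δ (state v t).1 (v t)) (y - (state v t).1))
      (sphereSeq d) := hpot.add hinner
  have hstep := integral_le_integral_add_const (H.integrable_potential (H.mem_X hy) (t + 1))
    (hsum.add hdual) fun v => H.potential_succ_le hy v t hyc hc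
  simp only [Pi.add_apply] at hstep
  rw [integral_add hsum hdual, integral_add hpot hinner, integral_const_mul,
    integral_const_mul] at hstep
  linarith [mul_le_mul_of_nonneg_left (H.integral_inner_gradEst_state_le hy t) H.a_pos.le]

theorem integral_potential_change_le {y' : Vec d} (hy : y ∈ Q.X) (hy' : y' ∈ Q.X) (t : ℕ) :
    ∫ v, potential y' (state v t) ∂sphereSeq d ≤
      ∫ v, potential y (state v t) ∂sphereSeq d + 2 * R * ‖y' - y‖ :=
  integral_le_integral_add_const (H.integrable_potential hy' t) (H.integrable_potential hy t)
    fun v => potential_le_potential_add (H.norm_sub_le_of_mem hy (H.iterate_mem v t))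
      (H.norm_sub_le_of_mem hy' (H.iterate_mem v t))

theorem integral_potential_add_sum_le {ys : ℕ → Vec d} {c : ℝ}
    (hys : ∀ t, ys t ∈ (1 - δ / r) • Q.X) (hyc : ∀ t n, Q.g t (ys t) n ≤ c) (hc : -η ≤ c)
    (T : ℕ) :
    ∫ v, potential (ys T) (state v T) ∂sphereSeq d
      + a * ∑ t ∈ Finset.range T, ∫ v, Q.f t (state v t).1 ∂sphereSeq d ≤
    a * ∑ t ∈ Finset.range T, Q.f t (ys t)
      + (2 * R ^ 2 + 2 * R * ∑ t ∈ Finset.range T, ‖ys (t + 1) - ys t‖)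
      + a * (T * (2 * δ * G + a * stepConst N G η R B))
      + a * c * ∑ t ∈ Finset.range T, ∫ v, ∑ n, (state v t).2 n ∂sphereSeq d := by
  have hmem (t : ℕ) := H.mem_X (hys t)
  induction T with
  | zero =>
    have hinit := integral_mono (H.integrable_potential (hmem 0) 0)
      (integrable_const (2 * R ^ 2)) (H.potential_init_le (hmem 0))
    simpa using hinit
  | succ T ih =>
    have hstep := H.integral_potential_succ_le (hys T) T (hyc T) hc
    have hchange := H.integral_potential_change_le (hmem T) (hmem (T + 1)) (T + 1)
    simp only [Finset.sum_range_succ]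
    push_cast
    linarith

theorem sum_integral_f_le {ys : ℕ → Vec d} {c : ℝ}
    (hys : ∀ t, ys t ∈ (1 - δ / r) • Q.X) (hyc : ∀ t n, Q.g t (ys t) n ≤ c) (hc : -η ≤ c)
    (T : ℕ) :
    ∑ t ∈ Finset.range T, ∫ v, Q.f t (state v t).1 ∂sphereSeq d ≤
      ∑ t ∈ Finset.range T, Q.f t (ys t)
      + (2 * R ^ 2 + 2 * R * ∑ t ∈ Finset.range T, ‖ys (t + 1) - ys t‖) / a
      + T * (2 * δ * G + a * stepConst N G η R B)
      + c * ∑ t ∈ Finset.range T, ∫ v, ∑ n, (state v t).2 n ∂sphereSeq d := by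
  have hsum := H.integral_potential_add_sum_le hys hyc hc T
  have hpot : 0 ≤ ∫ v, potential (ys T) (state v T) ∂sphereSeq d :=
    integral_nonneg fun v => potential_nonneg _ _
  refine le_of_mul_le_mul_left ?_ H.a_pos
  rw [mul_add, mul_add, mul_add, mul_div_cancel₀ _ H.a_pos.ne']
  linarith

theorem neg_le_integral_f (t : ℕ) : -F ≤ ∫ v, Q.f t (state v t).1 ∂sphereSeq d := by
  have hmono := integral_mono (integrable_const (-F)) (H.integrable_f t)
    fun v => neg_le_of_abs_le (H.bound_f t _ (H.iterate_mem v t))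
  simpa using hmono

theorem sum_integral_dual_le (T : ℕ) :
    ∑ t ∈ Finset.range T, ∫ v, ∑ n, (state v t).2 n ∂sphereSeq d ≤
      (2 * R ^ 2 / a + T * (2 * F + 2 * δ * G + a * stepConst N G η R B)) / η := by
  have hsum := H.sum_integral_f_le (fun _ => H.slater_mem) H.slater_le le_rfl T
  have hlower : T * -F ≤ ∑ t ∈ Finset.range T, ∫ v, Q.f t (state v t).1 ∂sphereSeq d := by
    simpa using Finset.card_nsmul_le_sum (Finset.range T) _ _ fun t _ => H.neg_le_integral_f t
  have hupper : ∑ t ∈ Finset.range T, Q.f t z ≤ T * F := by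
    simpa using Finset.sum_le_card_nsmul (Finset.range T) _ _ fun t _ =>
      le_of_abs_le (H.bound_f t z (H.mem_X H.slater_mem))
  simp only [sub_self, norm_zero, Finset.sum_const_zero, mul_zero, add_zero] at hsum
  rw [le_div_iff₀ H.eta_pos]
  linarith

end Expectation

/-! ### The regret of a bounded run -/

section Regret

variable [NeZero d] {xs : ℕ → Vec d}
include H

theorem integral_f_action_le (t : ℕ) (m : Fin fb.M) :
    ∫ v, Q.f t (Q.action fb (coupledParams r a δ) x₁ v t m) ∂sphereSeq d ≤
      ∫ v, Q.f t (state v t).1 ∂sphereSeq d + G * δ := by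
  refine integral_le_integral_add_const (H.integrable_f_action t m) (H.integrable_f t) fun v => ?_
  have hlip := H.f_sub_le t (H.action_mem v t m) (state v t).1
  rw [H.norm_action_sub_iterate] at hlip
  linarith

theorem average_integral_f_action_le (T : ℕ) :
    1 / (fb.M : ℝ) * ∑ t ∈ Finset.range T, ∑ m,
      ∫ v, Q.f t (Q.action fb (coupledParams r a δ) x₁ v t m) ∂sphereSeq d ≤
    ∑ t ∈ Finset.range T, ∫ v, Q.f t (state v t).1 ∂sphereSeq d + T * (G * δ) := by
  have hM : (0 : ℝ) < fb.M := by exact_mod_cast fb.M_pos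
  rw [one_div, inv_mul_le_iff₀ hM]
  calc _ ≤ ∑ t ∈ Finset.range T,
        (fb.M : ℝ) * (∫ v, Q.f t (state v t).1 ∂sphereSeq d + G * δ) := by
        refine Finset.sum_le_sum fun t _ => ?_
        simpa only [Finset.card_univ, Fintype.card_fin, nsmul_eq_mul] using
          Finset.sum_le_card_nsmul Finset.univ _ _ fun m _ => H.integral_f_action_le t m
    _ = _ := by simp [← Finset.mul_sum, Finset.sum_add_distrib]

theorem regret_le (hxs : ∀ t, xs t ∈ Q.X ∧ ∀ n, Q.g t (xs t) n ≤ 0) (T : ℕ) :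
    Q.regret fb (coupledParams r a δ) x₁ (sphereSeq d) (fun t v => v t) xs T ≤
      T * (3 * δ * G + G * (δ / r) * R + a * stepConst N G η R B)
      + (6 * R ^ 2 + 2 * R * variation xs T) / a
      + G * (δ / r) * R *
        ((2 * R ^ 2 / a + T * (2 * F + 2 * δ * G + a * stepConst N G η R B)) / η) := by
  have hc : 0 ≤ G * (δ / r) * R :=
    mul_nonneg (mul_nonneg H.G_nonneg (div_nonneg H.δ_pos.le H.r_pos.le)) H.R_pos.le
  have hmem (t : ℕ) : xs t ∈ Q.X := (hxs t).1
  have hiter := H.sum_integral_f_le (ys := fun t => (1 - δ / r) • xs t)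
    (fun t => Set.smul_mem_smul_set (hmem t))
    (fun t n => (H.g_shrink_le H.δ_pos.le H.δ_le t n (hmem t)).trans
      (add_le_of_nonpos_left ((hxs t).2 n)))
    (by linarith [H.eta_pos]) T
  have hcomp : ∑ t ∈ Finset.range T, Q.f t ((1 - δ / r) • xs t) ≤
      ∑ t ∈ Finset.range T, Q.f t (xs t) + T * (G * (δ / r) * R) := by
    refine (Finset.sum_le_sum fun t _ => H.f_shrink_le H.δ_pos.le H.δ_le t (hmem t)).trans_eq ?_
    simp [Finset.sum_add_distrib]
  have hvar : (2 * R ^ 2 + 2 * R *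
      ∑ t ∈ Finset.range T, ‖(1 - δ / r) • xs (t + 1) - (1 - δ / r) • xs t‖) / a ≤
      (6 * R ^ 2 + 2 * R * variation xs T) / a := by
    refine div_le_div_of_nonneg_right ?_ H.a_pos.le
    linarith [mul_le_mul_of_nonneg_left (H.sum_norm_shrink_sub_le H.δ_pos.le H.δ_le hmem T)
      (mul_nonneg zero_le_two H.R_pos.le)]
  have hdual := mul_le_mul_of_nonneg_left (H.sum_integral_dual_le T) hc
  unfold regret
  linarith [H.average_integral_f_action_le T]

end Regret

end BoundedRun

end OnlineProblem

/-! ### The fit of a bounded run -/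

theorem norm_le_of_forall_abs_le {N : ℕ} {y : Vec N} {b : ℝ} (hb : ∀ n, |y n| ≤ b) :
    ‖y‖ ≤ N * b := by
  have hy : y = ∑ n, EuclideanSpace.single n (y n) := by
    ext m
    simp
  calc ‖y‖ ≤ ∑ n, ‖EuclideanSpace.single n (y n)‖ := by
        conv_lhs => rw [hy]
        exact norm_sum_le _ _
    _ ≤ ∑ _n : Fin N, b := Finset.sum_le_sum fun n _ => by simpa using hb n
    _ = N * b := by simp

namespace OnlineProblem

variable {d N : ℕ} {Q : OnlineProblem d N} {fb : Feedback}

theorem average_g_action_le {p : BanSaPParams} {x₁ : Vec d} {v : ℕ → UnitSphere d} {t : ℕ}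
    {n : Fin N} {b : ℝ} (hb : ∀ m, Q.g t (Q.action fb p x₁ v t m) n ≤ b) :
    1 / (fb.M : ℝ) * ∑ m, Q.g t (Q.action fb p x₁ v t m) n ≤ b := by
  have hM : (0 : ℝ) < fb.M := by exact_mod_cast fb.M_pos
  rw [one_div, inv_mul_le_iff₀ hM]
  simpa using Finset.sum_le_card_nsmul Finset.univ _ _ fun m _ => hb m

theorem fit_le_of_forall_sum_le {p : BanSaPParams} {x₁ : Vec d} {v : ℕ → UnitSphere d} {T : ℕ}
    {b : ℝ} (hb : 0 ≤ b) (h : ∀ n, ∑ t ∈ Finset.range T,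
      1 / (fb.M : ℝ) * ∑ m, Q.g t (Q.action fb p x₁ v t m) n ≤ b) :
    Q.fit fb p x₁ v T ≤ N * b := by
  refine norm_le_of_forall_abs_le fun n => ?_
  rw [abs_of_nonneg (le_max_right _ _)]
  simp only [Finset.mul_sum] at h ⊢
  exact max_le (h n) hb

namespace BoundedRun

variable {F G η r R a δ B : ℝ} {x₁ z : Vec d} (H : Q.BoundedRun fb F G η r R a δ B x₁ z)

local notation "state" => Q.iterate fb (coupledParams r a δ) x₁

section Fit

include H

theorem norm_iterate_succ_sub_le (v : ℕ → UnitSphere d) (t : ℕ) :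
    ‖(state v (t + 1)).1 - (state v t).1‖ ≤ a * (B + G * ∑ n, (state v t).2 n) := by
  obtain ⟨hx, hl⟩ := H.feasible v t
  refine (norm_proj_sub_sub_le (H.nonempty_smul _) (H.isClosed_smul _) (H.convex_X.smul _) hx
    (a • Q.lagrangianGradEst fb δ t (state v t).1 (state v t).2 (v t))).trans ?_
  rw [norm_smul, Real.norm_eq_abs, abs_of_pos H.a_pos]
  refine mul_le_mul_of_nonneg_left ?_ H.a_pos.le
  refine (norm_add_le _ _).trans (add_le_add (H.norm_gradEst_le t _ hx _) ?_)
  rw [Finset.mul_sum]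
  refine (norm_sum_le _ _).trans (Finset.sum_le_sum fun n _ => ?_)
  rw [norm_smul, Real.norm_eq_abs, abs_of_nonneg (hl n), mul_comm]
  exact mul_le_mul_of_nonneg_right (H.grad_g t n _ (H.iterate_mem v t)) (hl n)

theorem g_iterate_le (v : ℕ → UnitSphere d) (t : ℕ) (n : Fin N) :
    Q.g t (state v t).1 n ≤ ((state v (t + 1)).2 n - (state v t).2 n) / a
      + G * ‖(state v (t + 1)).1 - (state v t).1‖ := by
  set w := (state v (t + 1)).1 - (state v t).1
  have hdual : (state v t).2 n + a * (Q.g t (state v t).1 n +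
      inner ℝ (∇ (fun y => Q.g t y n) (state v t).1) w) ≤ (state v (t + 1)).2 n := le_max_left _ _
  have hlin : Q.g t (state v t).1 n + inner ℝ (∇ (fun y => Q.g t y n) (state v t).1) w ≤
      ((state v (t + 1)).2 n - (state v t).2 n) / a := by
    rw [le_div_iff₀ H.a_pos]
    linarith
  linarith [neg_le_of_abs_le (abs_inner_le_mul_norm (H.grad_g t n _ (H.iterate_mem v t)) w)]

theorem sum_average_g_action_le (v : ℕ → UnitSphere d) (T : ℕ) (n : Fin N) :
    ∑ t ∈ Finset.range T, 1 / (fb.M : ℝ) *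
        ∑ m, Q.g t (Q.action fb (coupledParams r a δ) x₁ v t m) n ≤
      (state v T).2 n / a
        + ∑ t ∈ Finset.range T, G * ‖(state v (t + 1)).1 - (state v t).1‖ + T * (G * δ) := by
  have hslot (t : ℕ) : 1 / (fb.M : ℝ) *
      ∑ m, Q.g t (Q.action fb (coupledParams r a δ) x₁ v t m) n ≤
      ((state v (t + 1)).2 n / a - (state v t).2 n / a)
        + G * ‖(state v (t + 1)).1 - (state v t).1‖ + G * δ := by
    refine average_g_action_le fun m => ?_
    have hlip := H.g_sub_le t n (H.action_mem v t m) (state v t).1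
    rw [H.norm_action_sub_iterate] at hlip
    rw [← sub_div]
    linarith [H.g_iterate_le v t n]
  refine (Finset.sum_le_sum fun t _ => hslot t).trans_eq ?_
  rw [Finset.sum_add_distrib, Finset.sum_add_distrib,
    Finset.sum_range_sub (fun t => (state v t).2 n / a)]
  simp [iterate]

theorem fit_le {v : ℕ → UnitSphere d} {T : ℕ} {Λ : ℝ}
    (hΛ : ∀ t ≤ T, ∑ n, (state v t).2 n ≤ Λ) :
    Q.fit fb (coupledParams r a δ) x₁ v T ≤
      N * (Λ / a + T * (G * (a * (B + G * Λ))) + T * (G * δ)) := by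
  have hG := H.G_nonneg
  have ha := H.a_pos
  have hδ := H.δ_pos
  have hB := H.B_nonneg
  have hΛ₀ : 0 ≤ Λ := (Finset.sum_nonneg fun n _ => (H.feasible v 0).2 n).trans
    (hΛ 0 (Nat.zero_le _))
  refine fit_le_of_forall_sum_le (by positivity) fun n => ?_
  have hdual : (state v T).2 n ≤ Λ :=
    (Finset.single_le_sum (fun n _ => (H.feasible v T).2 n) (Finset.mem_univ n)).trans
      (hΛ T le_rfl)
  have hsteps : ∑ t ∈ Finset.range T, G * ‖(state v (t + 1)).1 - (state v t).1‖ ≤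
      T * (G * (a * (B + G * Λ))) := by
    refine (Finset.sum_le_card_nsmul _ _ (G * (a * (B + G * Λ))) fun t ht => ?_).trans_eq
      (by simp)
    have hstep := H.norm_iterate_succ_sub_le v t
    have hsum := hΛ t (Finset.mem_range.1 ht).le
    exact mul_le_mul_of_nonneg_left (hstep.trans (by gcongr)) hG
  exact (H.sum_average_g_action_le v T n).trans (by gcongr)

theorem fit_le_mul_horizon (v : ℕ → UnitSphere d) (T : ℕ) :
    Q.fit fb (coupledParams r a δ) x₁ v T ≤ N * (T * (2 * R * G)) := by
  have hRG : 0 ≤ 2 * R * G := mul_nonneg (mul_nonneg zero_le_two H.R_pos.le) H.G_nonneg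
  refine fit_le_of_forall_sum_le (mul_nonneg T.cast_nonneg hRG) fun n => ?_
  refine (Finset.sum_le_card_nsmul _ _ (2 * R * G) fun t _ =>
    average_g_action_le fun m => ?_).trans_eq (by simp)
  linarith [H.g_le t n (H.action_mem v t m), H.eta_pos]

end Fit

end BoundedRun

/-! ### Drift of the dual iterates -/

theorem sum_dual_le_of_potential_le {y : Vec d} {s : Vec d × Vec N} {c : ℝ}
    (hs : potential y s ≤ c) : ∑ n, s.2 n ≤ N * (2 * c + 1) := by
  have hentry (n : Fin N) : s.2 n ≤ 2 * c + 1 := by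
    unfold potential at hs
    have habs : |s.2 n| ≤ ‖s.2‖ := PiLp.norm_apply_le s.2 n
    linarith [le_abs_self (s.2 n), sq_nonneg ‖y - s.1‖, sq_nonneg ‖s.2‖, sq_nonneg (‖s.2‖ - 1)]
  exact (Finset.sum_le_card_nsmul Finset.univ _ _ fun n _ => hentry n).trans_eq
    (by simp only [Finset.card_univ, Fintype.card_fin, nsmul_eq_mul])

theorem potential_le_of_sum_dual_le {y : Vec d} {s : Vec d × Vec N} {L D : ℝ}
    (hs : ∀ n, 0 ≤ s.2 n) (hL : ∑ n, s.2 n ≤ L) (hD : ‖y - s.1‖ ≤ 2 * D) :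
    potential y s ≤ L ^ 2 / 2 + 2 * D ^ 2 := by
  have hdual : ‖s.2‖ ^ 2 ≤ L ^ 2 := by
    simp only [EuclideanSpace.norm_sq_eq, Real.norm_eq_abs, sq_abs]
    exact (Finset.sum_sq_le_sq_sum_of_nonneg fun n _ => hs n).trans
      (pow_le_pow_left₀ (Finset.sum_nonneg fun n _ => hs n) hL 2)
  have hprimal := pow_le_pow_left₀ (norm_nonneg _) hD 2
  unfold potential
  linarith

namespace BoundedRun

variable {F G η r R a δ B L : ℝ} {x₁ z : Vec d} (H : Q.BoundedRun fb F G η r R a δ B x₁ z)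

local notation "state" => Q.iterate fb (coupledParams r a δ) x₁

section Drift

variable (hincr : a * (2 * R * B) + a ^ 2 * stepConst N G η R B ≤ 1)
include H

theorem potential_slater_succ_le_sub {κ : ℝ} (hκ : κ + a * stepConst N G η R B ≤ η * L)
    {v : ℕ → UnitSphere d} {t : ℕ} (hL : L ≤ ∑ n, (state v t).2 n) :
    potential z (state v (t + 1)) ≤ potential z (state v t)
      + a * (inner ℝ (fb.gradEst (Q.f t) δ (state v t).1 (v t)) (z - (state v t).1) - κ) := by
  have hstep := H.potential_succ_le H.slater_mem v t (H.slater_le t) le_rfl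
  have hdrift := mul_le_mul_of_nonneg_left
    (hκ.trans (mul_le_mul_of_nonneg_left hL H.eta_pos.le)) H.a_pos.le
  linarith

include hincr

theorem potential_slater_succ_le_of_sum_dual_le {v : ℕ → UnitSphere d} {t : ℕ}
    (hL : ∑ n, (state v t).2 n ≤ L) :
    potential z (state v (t + 1)) ≤ L ^ 2 / 2 + 2 * R ^ 2 + 1 := by
  have hpot := potential_le_of_sum_dual_le (H.feasible v t).2 hL
    (H.norm_sub_le_of_mem (H.mem_X H.slater_mem) (H.iterate_mem v t))
  linarith [H.potential_slater_succ_le v t]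

theorem potential_slater_le_of_drift
    (hdrift : 2 * R * B + a * stepConst N G η R B ≤ η * L) (v : ℕ → UnitSphere d) (t : ℕ) :
    potential z (state v t) ≤ L ^ 2 / 2 + 2 * R ^ 2 + 1 := by
  induction t with
  | zero => linarith [H.potential_init_le (H.mem_X H.slater_mem) v, sq_nonneg L]
  | succ t ih =>
    rcases le_total (∑ n, (state v t).2 n) L with hL | hL
    · exact H.potential_slater_succ_le_of_sum_dual_le hincr hL
    · have hinner := mul_nonneg H.a_pos.le (sub_nonneg.2
        (le_of_abs_le (H.abs_inner_gradEst_le (H.feasible v t).1 H.slater_mem t (v t))))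
      linarith [H.potential_slater_succ_le_sub hdrift hL]

theorem exp_potential_succ_le {θ κ : ℝ} (hθ : 0 ≤ θ)
    (hdrift : κ + a * stepConst N G η R B ≤ η * L) (v : ℕ → UnitSphere d) (t : ℕ) :
    Real.exp (θ * potential z (state v (t + 1))) ≤
      Real.exp (θ * potential z (state v t)) * Real.exp (θ * a *
        (inner ℝ (fb.gradEst (Q.f t) δ (state v t).1 (v t)) (z - (state v t).1) - κ))
      + Real.exp (θ * (L ^ 2 / 2 + 2 * R ^ 2 + 1)) := by
  rcases le_total (∑ n, (state v t).2 n) L with hL | hL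
  · refine le_add_of_nonneg_of_le (by positivity) (Real.exp_le_exp.2 ?_)
    exact mul_le_mul_of_nonneg_left (H.potential_slater_succ_le_of_sum_dual_le hincr hL) hθ
  · refine le_add_of_le_of_nonneg ?_ (Real.exp_pos _).le
    rw [← Real.exp_add, Real.exp_le_exp, mul_assoc, ← mul_add]
    exact mul_le_mul_of_nonneg_left (H.potential_slater_succ_le_sub hdrift hL) hθ

end Drift

end BoundedRun

end OnlineProblem

/-! ### Exponential moments of the potential -/

theorem integral_exp_mul_sub_le_one {Ω : Type*} [MeasurableSpace Ω] {P : Measure Ω}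
    [IsProbabilityMeasure P] {ξ : Ω → ℝ} {b c κ : ℝ} (hξ : AEStronglyMeasurable ξ P)
    (hb : ∀ ω, |ξ ω| ≤ b) (hc : 0 ≤ c) (hcb : c * b ≤ 1)
    (hκ : ∫ ω, ξ ω ∂P + c * b ^ 2 ≤ κ) : ∫ ω, Real.exp (c * (ξ ω - κ)) ∂P ≤ 1 := by
  have hcξ (ω : Ω) : |c * ξ ω| ≤ c * b := by
    rw [abs_mul, abs_of_nonneg hc]
    exact mul_le_mul_of_nonneg_left (hb ω) hc
  have hpt (ω : Ω) : Real.exp (c * ξ ω) ≤ c * ξ ω + (1 + (c * b) ^ 2) := by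
    linarith [le_of_abs_le (Real.abs_exp_sub_one_sub_id_le ((hcξ ω).trans hcb)),
      sq_le_sq' (neg_le_of_abs_le (hcξ ω)) (le_of_abs_le (hcξ ω))]
  have hint : Integrable (fun ω => c * ξ ω) P :=
    (Integrable.of_bound hξ b (ae_of_all _ hb)).const_mul c
  have hexp : Integrable (fun ω => Real.exp (c * ξ ω)) P :=
    .of_bound (Real.continuous_exp.comp_aestronglyMeasurable (hξ.const_mul c)) (Real.exp (c * b))
      (ae_of_all _ fun ω => by
        simpa [Real.abs_exp] using (le_of_abs_le (hcξ ω)))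
  have hmoment : ∫ ω, Real.exp (c * ξ ω) ∂P ≤ Real.exp (c * κ) := by
    have hle := integral_le_integral_add_const hexp hint hpt
    rw [integral_const_mul] at hle
    linarith [Real.add_one_le_exp (c * κ), mul_le_mul_of_nonneg_left hκ hc]
  simp only [mul_sub, Real.exp_sub, integral_div]
  exact (div_le_one (Real.exp_pos _)).2 hmoment

namespace OnlineProblem.BoundedRun

variable {d N : ℕ} [NeZero d] {Q : OnlineProblem d N} {fb : Feedback}
  {F G η r R a δ B θ L κ : ℝ} {x₁ z : Vec d} (H : Q.BoundedRun fb F G η r R a δ B x₁ z)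

local notation "state" => Q.iterate fb (coupledParams r a δ) x₁

section ExpMoment

variable (hθ : 0 ≤ θ)
include H hθ

theorem integrable_exp_potential (t : ℕ) :
    Integrable (fun v => Real.exp (θ * potential z (state v t))) (sphereSeq d) := by
  have hm : Measurable fun v => Real.exp (θ * potential z (state v t)) :=
    (((continuous_potential z).measurable.comp (H.measurable_iterate fb _ x₁ t)).const_mul θ).exp
  refine .of_bound hm.aestronglyMeasurable (Real.exp (θ * (2 * R ^ 2 + t *
    (a * (2 * R * B) + a ^ 2 * stepConst N G η R B)))) (ae_of_all _ fun v => ?_)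
  rw [Real.norm_eq_abs, Real.abs_exp]
  gcongr
  exact H.potential_slater_le v t

theorem integrable_exp_potential_mul (κ : ℝ) (t : ℕ) :
    Integrable (fun v => Real.exp (θ * potential z (state v t)) * Real.exp (θ * a *
      (inner ℝ (fb.gradEst (Q.f t) δ (state v t).1 (v t)) (z - (state v t).1) - κ)))
      (sphereSeq d) := by
  have hm := (((H.measurable_inner_gradEst fb δ z t).comp ((H.measurable_iterate fb
    (coupledParams r a δ) x₁ t).prodMk (measurable_pi_apply t))).sub_const κ).const_mul (θ * a)
  refine (H.integrable_exp_potential hθ t).mul_bdd (c := Real.exp (θ * a * (2 * R * B - κ)))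
    hm.exp.aestronglyMeasurable (ae_of_all _ fun v => ?_)
  rw [Real.norm_eq_abs, Real.abs_exp]
  have ha := H.a_pos
  gcongr
  exact le_of_abs_le (H.abs_inner_gradEst_le (H.feasible v t).1 H.slater_mem t (v t))

variable (hθB : θ * a * (2 * R * B) ≤ 1)
  (hκ : 2 * F + 2 * δ * G + θ * a * (2 * R * B) ^ 2 ≤ κ)
include hθB hκ

theorem integral_exp_inner_gradEst_le_one (t : ℕ) {x : Vec d} (hx : x ∈ (1 - δ / r) • Q.X) :
    ∫ v, Real.exp (θ * a * (inner ℝ (fb.gradEst (Q.f t) δ x v) (z - x) - κ)) ∂uniformSphere d ≤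
      1 := by
  have hcont : Continuous fun v : UnitSphere d => inner ℝ (fb.gradEst (Q.f t) δ x v) (z - x) :=
    ((fb.continuous_gradEst (H.continuous_f t) δ).comp (.prodMk_right x)).inner continuous_const
  refine integral_exp_mul_sub_le_one hcont.aestronglyMeasurable
    (fun v => H.abs_inner_gradEst_le hx H.slater_mem t v) (mul_nonneg hθ H.a_pos.le) hθB ?_
  linarith [H.integral_inner_gradEst_le fb H.δ_pos H.δ_le t hx H.slater_mem,
    neg_le_of_abs_le (H.bound_f t x (H.mem_X hx)),
    le_of_abs_le (H.bound_f t z (H.mem_X H.slater_mem))]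

theorem integral_exp_potential_mul_le (t : ℕ) :
    ∫ v, Real.exp (θ * potential z (state v t)) * Real.exp (θ * a *
        (inner ℝ (fb.gradEst (Q.f t) δ (state v t).1 (v t)) (z - (state v t).1) - κ))
        ∂sphereSeq d ≤
      ∫ v, Real.exp (θ * potential z (state v t)) ∂sphereSeq d := by
  have hm : Measurable fun q : (Vec d × Vec N) × UnitSphere d =>
      Real.exp (θ * potential z q.1) * Real.exp (θ * a *
        (inner ℝ (fb.gradEst (Q.f t) δ q.1.1 q.2) (z - q.1.1) - κ)) :=
    (((continuous_potential z).measurable.comp measurable_fst).const_mul θ).exp.mul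
      (((H.measurable_inner_gradEst fb δ z t).sub_const κ).const_mul (θ * a)).exp
  refine H.integral_iterate_le fb (coupledParams r a δ) t H.init_mem hm
    (H.integrable_exp_potential_mul hθ κ t) (ψ := fun s => Real.exp (θ * potential z s))
    (fun s hs => ?_) (H.integrable_exp_potential hθ t)
  simp only [integral_const_mul]
  exact mul_le_of_le_one_right (Real.exp_pos _).le
    (H.integral_exp_inner_gradEst_le_one hθ hθB hκ t hs.1)

variable (hincr : a * (2 * R * B) + a ^ 2 * stepConst N G η R B ≤ 1)
  (hdrift : κ + a * stepConst N G η R B ≤ η * L)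
include hincr hdrift

theorem integral_exp_potential_le (t : ℕ) :
    ∫ v, Real.exp (θ * potential z (state v t)) ∂sphereSeq d ≤
      (t + 1) * Real.exp (θ * (L ^ 2 / 2 + 2 * R ^ 2 + 1)) := by
  induction t with
  | zero =>
    have hinit (v : ℕ → UnitSphere d) : Real.exp (θ * potential z (state v 0)) ≤
        Real.exp (θ * (L ^ 2 / 2 + 2 * R ^ 2 + 1)) := by
      gcongr
      linarith [H.potential_init_le (H.mem_X H.slater_mem) v, sq_nonneg L]
    simpa using integral_mono (H.integrable_exp_potential hθ 0) (integrable_const _) hinit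
  | succ t ih =>
    have hstep := integral_le_integral_add_const (H.integrable_exp_potential hθ (t + 1))
      (H.integrable_exp_potential_mul hθ κ t)
      fun v => H.exp_potential_succ_le hincr hθ hdrift v t
    push_cast
    linarith [H.integral_exp_potential_mul_le hθ hθB hκ t]

theorem measureReal_potential_ge_le (t : ℕ) :
    (sphereSeq d).real {v | L ^ 2 / 2 + 2 * R ^ 2 + 2 ≤ potential z (state v t)} ≤
      (t + 1) * Real.exp (-θ) := by
  set c := L ^ 2 / 2 + 2 * R ^ 2 + 1 with hc
  have hmarkov := mul_meas_ge_le_integral_of_nonneg (ae_of_all _ fun v => (Real.exp_pos _).le)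
    (H.integrable_exp_potential hθ t) (Real.exp (θ * (c + 1)))
  have hsub : (sphereSeq d).real {v | L ^ 2 / 2 + 2 * R ^ 2 + 2 ≤ potential z (state v t)} ≤
      (sphereSeq d).real {v | Real.exp (θ * (c + 1)) ≤
        Real.exp (θ * potential z (state v t))} :=
    measureReal_mono fun v hv => Real.exp_le_exp.2 (mul_le_mul_of_nonneg_left
      ((by rw [hc]; ring : c + 1 = L ^ 2 / 2 + 2 * R ^ 2 + 2).trans_le hv) hθ)
  refine hsub.trans (le_of_mul_le_mul_left ?_ (Real.exp_pos (θ * (c + 1))))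
  calc _ ≤ (t + 1) * Real.exp (θ * c) :=
        hmarkov.trans (H.integral_exp_potential_le hθ hθB hκ hincr hdrift t)
    _ = Real.exp (θ * (c + 1)) * ((t + 1) * Real.exp (-θ)) := by
        rw [mul_left_comm, ← Real.exp_add]
        ring_nf

theorem measureReal_exists_potential_ge_le (T : ℕ) :
    (sphereSeq d).real {v | ∃ t ≤ T, L ^ 2 / 2 + 2 * R ^ 2 + 2 ≤ potential z (state v t)} ≤
      (T + 1) ^ 2 * Real.exp (-θ) := by
  have hunion : {v | ∃ t ≤ T, L ^ 2 / 2 + 2 * R ^ 2 + 2 ≤ potential z (state v t)} =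
      ⋃ t ∈ Finset.range (T + 1),
        {v | L ^ 2 / 2 + 2 * R ^ 2 + 2 ≤ potential z (state v t)} := by
    ext v
    simp
  rw [hunion]
  calc _ ≤ ∑ t ∈ Finset.range (T + 1), (sphereSeq d).real _ := measureReal_biUnion_finset_le _ _
    _ ≤ ∑ _t ∈ Finset.range (T + 1), (T + 1) * Real.exp (-θ) := by
        refine Finset.sum_le_sum fun t ht =>
          (H.measureReal_potential_ge_le hθ hθB hκ hincr hdrift t).trans ?_
        gcongr
        exact Finset.mem_range_succ_iff.1 ht
    _ = (T + 1) ^ 2 * Real.exp (-θ) := by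
        simp only [Finset.sum_const, Finset.card_range, nsmul_eq_mul]
        push_cast
        ring

end ExpMoment

end OnlineProblem.BoundedRun

/-! ### Rates of the regret and fit bounds -/

/-- The rate `T / y`, with constant `c`, of a run over the horizon `T` with step size `a` and
perturbation `δ`, where `K` stands for the constant `stepConst` of the run and `V` for the
variation of the comparator: every error term is of the order that makes the regret and the fit
at most of order `T / y`. -/
structure HasRate (c T y a δ K V : ℝ) : Prop where
  one_le : 1 ≤ y
  le_horizon : y ≤ T
  a_pos : 0 < a
  δ_pos : 0 < δ
  a_le : a ≤ c / y
  δ_le : δ ≤ c / y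
  step_le : a * K ≤ c / y
  inv_le : 1 / a ≤ c * (T / y)
  variation_le : V / a ≤ c * (T / y)

/-- The constant in the regret bound for runs whose rate has the constant `c`. -/
noncomputable def regretConst (F G η r R c : ℝ) : ℝ :=
  3 * c * G + G * (c / r) * R + c + (6 * R ^ 2 + 2 * R) * c
    + G * (c / r) * R * ((2 * R ^ 2 * c + 2 * F + 2 * c * G + c) / η)

/-- The constant in the fit bound for runs whose rate has the constant `c`, when the sum of the
dual iterates is at most `Λ`. -/
noncomputable def fitConst (N : ℕ) (G Λ c : ℝ) : ℝ :=
  N * (Λ * c + G * (2 * c + G * Λ * c) + G * c)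

/-- The constant of the rate for step sizes of order between `a₁` and `a₂`, a perturbation of order
`b`, a second-order term of order `κ` and a variation of order `ν`. -/
noncomputable def rateConst (a₁ a₂ b κ ν : ℝ) : ℝ :=
  1 / a₁ ⊔ ν / a₁ ⊔ a₂ ⊔ b ⊔ κ

namespace HasRate

variable {c T y a δ K V : ℝ}

theorem of_pow {a₁ a₂ b κ ν : ℝ} {k : ℕ} (hk : k ≠ 0) (ha₁ : 0 < a₁) (hy : 1 ≤ y)
    (hyT : y ^ (k + 1) ≤ T) (ha : a₁ / y ^ k ≤ a) (ha' : a ≤ a₂ / y ^ k) (hδ₀ : 0 < δ)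
    (hδ : δ ≤ b / y) (hK : a * K ≤ κ / y) (hV₀ : 0 ≤ V) (hV : V ≤ ν * (T / y ^ (k + 1))) :
    HasRate (rateConst a₁ a₂ b κ ν) T y a δ K V := by
  have hy₀ : 0 < y := one_pos.trans_le hy
  have hT₀ : 0 < T := (pow_pos hy₀ _).trans_le hyT
  have ha₀ : 0 < a := (div_pos ha₁ (pow_pos hy₀ k)).trans_le ha
  have ha₂ : 0 < a₂ := (div_pos_iff_of_pos_right (pow_pos hy₀ k)).1 (ha₀.trans_le ha')
  have hinv : 1 / a ≤ y ^ k / a₁ := by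
    rw [← one_div_div a₁]
    exact one_div_le_one_div_of_le (div_pos ha₁ (pow_pos hy₀ k)) ha
  have hpow : y ^ k ≤ T / y := (le_div_iff₀ hy₀).2 hyT
  have hyk : y ≤ y ^ k := le_self_pow₀ hy hk
  refine ⟨hy, (le_self_pow₀ hy k.succ_ne_zero).trans hyT, ha₀, hδ₀, ?_, hδ.trans ?_, hK.trans ?_,
    ?_, ?_⟩
  · calc a ≤ a₂ / y := ha'.trans (by gcongr)
      _ ≤ _ := by gcongr; simp [rateConst]
  · gcongr; simp [rateConst]
  · gcongr; simp [rateConst]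
  · calc 1 / a ≤ 1 / a₁ * (T / y) := by
          rw [one_div_mul_eq_div]
          exact hinv.trans (by gcongr)
      _ ≤ _ := by gcongr; simp [rateConst]
  · calc V / a = V * (1 / a) := (mul_one_div V a).symm
      _ ≤ V * (y ^ k / a₁) := by gcongr
      _ ≤ ν * (T / y ^ (k + 1)) * (y ^ k / a₁) := by gcongr
      _ = ν / a₁ * (T / y) := by rw [pow_succ]; field_simp
      _ ≤ _ := by gcongr; simp [rateConst]

section

variable (hr : HasRate c T y a δ K V)
include hr

theorem pos : 0 < y :=
  one_pos.trans_le hr.one_le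

theorem const_pos : 0 < c :=
  (div_pos_iff_of_pos_right hr.pos).1 (hr.δ_pos.trans_le hr.δ_le)

theorem horizon_pos : 0 < T :=
  hr.pos.trans_le hr.le_horizon

theorem slater_gap_le {F G R : ℝ} (hG : 0 ≤ G) :
    2 * R ^ 2 / a + T * (2 * F + 2 * δ * G + a * K) ≤
      (2 * R ^ 2 * c + 2 * F + 2 * c * G + c) * T := by
  have hc := hr.const_pos
  have hT := hr.horizon_pos
  have hδ : δ ≤ c := hr.δ_le.trans (div_le_self hc.le hr.one_le)
  have hstep : a * K ≤ c := hr.step_le.trans (div_le_self hc.le hr.one_le)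
  have hinv : 1 / a ≤ c * T :=
    hr.inv_le.trans (mul_le_mul_of_nonneg_left (div_le_self hT.le hr.one_le) hc.le)
  calc 2 * R ^ 2 / a + T * (2 * F + 2 * δ * G + a * K)
      = 2 * R ^ 2 * (1 / a) + T * (2 * F + 2 * δ * G + a * K) := by ring
    _ ≤ 2 * R ^ 2 * (c * T) + T * (2 * F + 2 * c * G + c) := by gcongr
    _ = _ := by ring

theorem regret_bound_le (hK : 0 ≤ K) {F G η r R : ℝ} (hF : 0 ≤ F) (hG : 0 ≤ G) (hη : 0 < η)
    (hr₀ : 0 < r) (hR : 0 < R) :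
    T * (3 * δ * G + G * (δ / r) * R + a * K) + (6 * R ^ 2 + 2 * R * V) / a
      + G * (δ / r) * R * ((2 * R ^ 2 / a + T * (2 * F + 2 * δ * G + a * K)) / η) ≤
    regretConst F G η r R c * (T / y) := by
  have hgap := hr.slater_gap_le (F := F) (R := R) hG
  have hc := hr.const_pos
  have hy := hr.pos
  have hT := hr.horizon_pos
  obtain ⟨-, -, ha, hδ₀, -, hδ, hstep, hinv, hV⟩ := hr
  have hslots : T * (3 * δ * G + G * (δ / r) * R + a * K) ≤
      (3 * c * G + G * (c / r) * R + c) * (T / y) := by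
    calc _ ≤ T * (3 * (c / y) * G + G * ((c / y) / r) * R + c / y) := by gcongr
      _ = _ := by field_simp
  have htelescope : (6 * R ^ 2 + 2 * R * V) / a ≤ (6 * R ^ 2 + 2 * R) * c * (T / y) := by
    calc (6 * R ^ 2 + 2 * R * V) / a = 6 * R ^ 2 * (1 / a) + 2 * R * (V / a) := by ring
      _ ≤ 6 * R ^ 2 * (c * (T / y)) + 2 * R * (c * (T / y)) := by gcongr
      _ = _ := by ring
  have hshrink : G * (δ / r) * R * ((2 * R ^ 2 / a + T * (2 * F + 2 * δ * G + a * K)) / η) ≤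
      G * (c / r) * R * ((2 * R ^ 2 * c + 2 * F + 2 * c * G + c) / η) * (T / y) := by
    calc _ ≤ G * ((c / y) / r) * R *
          (((2 * R ^ 2 * c + 2 * F + 2 * c * G + c) * T) / η) := by gcongr
      _ = _ := by field_simp
  unfold regretConst
  linarith

theorem step_mul_le {B : ℝ} (hBK : B ≤ K + 1) : a * B ≤ 2 * c / y := by
  calc a * B ≤ a * (K + 1) := mul_le_mul_of_nonneg_left hBK hr.a_pos.le
    _ = a * K + a := by ring
    _ ≤ c / y + c / y := add_le_add hr.step_le hr.a_le
    _ = 2 * c / y := by ring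

theorem fit_bound_le {N : ℕ} {B G Λ : ℝ} (hBK : B ≤ K + 1) (hG : 0 ≤ G) (hΛ : 0 ≤ Λ) :
    N * (Λ / a + T * (G * (a * (B + G * Λ))) + T * (G * δ)) ≤
      fitConst N G Λ c * (T / y) := by
  have hstep := hr.step_mul_le hBK
  have hy := hr.pos
  have hT := hr.horizon_pos
  obtain ⟨-, -, -, -, ha, hδ, -, hinv, -⟩ := hr
  calc N * (Λ / a + T * (G * (a * (B + G * Λ))) + T * (G * δ))
      = N * (Λ * (1 / a) + T * (G * (a * B + G * Λ * a)) + T * (G * δ)) := by ring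
    _ ≤ N * (Λ * (c * (T / y)) + T * (G * (2 * c / y + G * Λ * (c / y))) + T * (G * (c / y))) := by
        gcongr
    _ = _ := by unfold fitConst; field_simp

theorem potential_increment_le {B R : ℝ} (hK : 0 ≤ K) (hBK : B ≤ K + 1) (hR : 0 ≤ R)
    (hy : (4 * R + 1) * c / y ≤ 1) : a * (2 * R * B) + a ^ 2 * K ≤ 1 := by
  have ha := hr.a_pos
  have hsum : 2 * R * (2 * c / y) + c / y ≤ 1 := (by ring : _ = (4 * R + 1) * c / y).trans_le hy
  have hterm : 0 ≤ 2 * R * (2 * c / y) := mul_nonneg (mul_nonneg zero_le_two hR)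
    (div_pos (mul_pos two_pos hr.const_pos) hr.pos).le
  have ha₁ : a ≤ 1 := hr.a_le.trans ((le_add_of_nonneg_left hterm).trans hsum)
  calc a * (2 * R * B) + a ^ 2 * K = 2 * R * (a * B) + a * (a * K) := by ring
    _ ≤ 2 * R * (2 * c / y) + 1 * (c / y) := by
        gcongr
        exacts [hr.step_mul_le hBK, hr.step_le]
    _ ≤ 1 := by rwa [one_mul]

end

end HasRate

theorem le_stepConst_add_one (N : ℕ) (G η R B : ℝ) :
    B ≤ OnlineProblem.stepConst N G η R B + 1 := by
  unfold OnlineProblem.stepConst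
  have hN : (0 : ℝ) ≤ N * (4 * R * G + η) ^ 2 := by positivity
  linarith [sq_nonneg (B - 1)]

theorem mul_stepConst_le_div {a a₂ b δ s B₀ : ℝ} (N : ℕ) (G η R : ℝ) (ha₀ : 0 ≤ a)
    (ha : a ≤ a₂ / s ^ 3) (hb : 0 < b) (hs : 1 ≤ s) (hδ : b / s ≤ δ) (hB₀ : 0 ≤ B₀) :
    a * OnlineProblem.stepConst N G η R (B₀ / δ) ≤
      a₂ * OnlineProblem.stepConst N G η R (B₀ / b) / s := by
  have hs₀ : 0 < s := one_pos.trans_le hs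
  have hδ₀ : 0 < δ := (div_pos hb hs₀).trans_le hδ
  have hB : B₀ / δ ≤ B₀ / b * s := by
    calc B₀ / δ ≤ B₀ / (b / s) := by gcongr
      _ = _ := by field_simp
  have hstep : OnlineProblem.stepConst N G η R (B₀ / δ) ≤
      OnlineProblem.stepConst N G η R (B₀ / b) * s ^ 2 := by
    calc ((B₀ / δ) ^ 2 + N * (4 * R * G + η) ^ 2) / 2
        ≤ ((B₀ / b * s) ^ 2 + N * (4 * R * G + η) ^ 2 * s ^ 2) / 2 := by
          refine div_le_div_of_nonneg_right (add_le_add (by gcongr) ?_) zero_le_two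
          exact le_mul_of_one_le_right (by positivity) (one_le_pow₀ hs)
      _ = ((B₀ / b) ^ 2 + N * (4 * R * G + η) ^ 2) / 2 * s ^ 2 := by ring
  have hK := OnlineProblem.stepConst_nonneg N G η R (B₀ / δ)
  calc _ ≤ a₂ / s ^ 3 * (OnlineProblem.stepConst N G η R (B₀ / b) * s ^ 2) :=
        mul_le_mul ha hstep hK (ha₀.trans ha)
    _ = _ := by field_simp

/-! ### Powers of the horizon -/

theorem rpow_eq_one_div_pow {T ε x : ℝ} (hT : 0 < T) (k : ℕ) (hx : x = -(k * ε)) :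
    T ^ x = 1 / (T ^ ε) ^ k := by
  rw [hx, Real.rpow_neg hT.le, one_div, ← Real.rpow_mul_natCast hT.le, mul_comm ε]

theorem rpow_eq_div_pow {T ε x : ℝ} (hT : 0 < T) (k : ℕ) (hx : x = 1 - k * ε) :
    T ^ x = T / (T ^ ε) ^ k := by
  rw [hx, Real.rpow_sub hT, Real.rpow_one, ← Real.rpow_mul_natCast hT.le, mul_comm ε]

theorem rpow_pow_le_self {T ε : ℝ} (hT : 1 ≤ T) (k : ℕ) (hε : k * ε ≤ 1) : (T ^ ε) ^ k ≤ T := by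
  rw [← Real.rpow_mul_natCast (zero_le_one.trans hT), mul_comm]
  exact Real.rpow_le_self_of_one_le hT hε

theorem tendsto_natCast_rpow_atTop {ε : ℝ} (hε : 0 < ε) :
    Tendsto (fun T : ℕ => (T : ℝ) ^ ε) atTop atTop :=
  (tendsto_rpow_atTop hε).comp tendsto_natCast_atTop_atTop

theorem eventually_div_rpow_le {ε c : ℝ} (hε : 0 < ε) (k : ℝ) (hc : 0 < c) :
    ∀ᶠ T : ℕ in atTop, k / (T : ℝ) ^ ε ≤ c :=
  ((tendsto_natCast_rpow_atTop hε).const_div_atTop k).eventually_le_const hc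

theorem eventually_sq_mul_exp_le {ε κ : ℝ} (hε : 0 < ε) (hκ : 0 < κ) :
    ∀ᶠ T : ℕ in atTop, ((T : ℝ) + 1) ^ 2 * Real.exp (-(κ * (T : ℝ) ^ ε)) ≤ 1 / (T : ℝ) ^ 2 := by
  have hlittle := (isLittleO_exp_neg_mul_rpow_atTop hκ (-(6 / ε))).comp_tendsto
    (tendsto_natCast_rpow_atTop hε)
  filter_upwards [hlittle.bound one_pos, eventually_ge_atTop 2] with T hexp hT
  have hT₂ : (2 : ℝ) ≤ T := by exact_mod_cast hT
  have hT₀ : (0 : ℝ) < T := two_pos.trans_le hT₂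
  have hexponent : -(6 / ε) = -((6 : ℕ) : ℝ) / ε := by
    push_cast
    ring
  simp only [Function.comp_apply, Real.norm_eq_abs, Real.abs_exp, one_mul, neg_mul] at hexp
  rw [abs_of_pos (by positivity), ← Real.rpow_mul hT₀.le, hexponent, mul_div_cancel₀ _ hε.ne',
    Real.rpow_neg hT₀.le, Real.rpow_natCast] at hexp
  calc ((T : ℝ) + 1) ^ 2 * Real.exp (-(κ * (T : ℝ) ^ ε))
      ≤ ((T : ℝ) ^ 2) ^ 2 * ((T : ℝ) ^ 6)⁻¹ := by
        gcongr
        nlinarith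
    _ = 1 / (T : ℝ) ^ 2 := by field_simp

theorem HasRate.of_rpow {a₁ a₂ b κ ν ρ ε x w T a δ K V : ℝ} {k : ℕ} (hk : k ≠ 0) (ha₁ : 0 < a₁)
    (hT : 1 ≤ T) (hρ : 0 ≤ ρ) (hε : 0 ≤ ε) (hρε : ρ = 1 - (k + 1 : ℕ) * ε) (hx : x = -(k * ε))
    (hw : w = -ε) (ha : a₁ * T ^ x ≤ a) (ha' : a ≤ a₂ * T ^ x) (hδ₀ : 0 < δ) (hδ : δ ≤ b * T ^ w)
    (hK : a * K ≤ κ / T ^ ε) (hV₀ : 0 ≤ V) (hV : V ≤ ν * T ^ ρ) :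
    HasRate (rateConst a₁ a₂ b κ ν) T (T ^ ε) a δ K V := by
  have hT₀ : 0 < T := one_pos.trans_le hT
  rw [rpow_eq_one_div_pow hT₀ k hx, mul_one_div] at ha ha'
  rw [rpow_eq_one_div_pow (ε := ε) hT₀ 1 (by simp [hw]), mul_one_div, pow_one] at hδ
  rw [rpow_eq_div_pow hT₀ (k + 1) hρε] at hV
  exact .of_pow hk ha₁ (Real.one_le_rpow hT hε) (rpow_pow_le_self hT _ (by linarith)) ha ha' hδ₀ hδ
    hK hV₀ hV

/-! ### From sequences of directions to general probability spaces -/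

theorem integrable_comp_of_hasLaw {Ω S : Type*} [MeasurableSpace Ω] [MeasurableSpace S]
    {P : Measure Ω} {ν : Measure S} {X : Ω → S} {φ : S → ℝ} (hX : HasLaw X ν P)
    (hφ : Integrable φ ν) : Integrable (fun ω => φ (X ω)) P := by
  rw [← hX.map_eq] at hφ
  exact hφ.comp_aemeasurable hX.aemeasurable

namespace OnlineProblem

variable {d N : ℕ} {Q : OnlineProblem d N} {fb : Feedback} {F G η r R : ℝ}

theorem fit_nonneg (p : BanSaPParams) (x₁ : Vec d) (v : ℕ → UnitSphere d) (T : ℕ) :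
    0 ≤ Q.fit fb p x₁ v T :=
  norm_nonneg _

theorem Regular.measurableSet_exists_potential_ge (h : Q.Regular F G η r R) (p : BanSaPParams)
    (x₁ z : Vec d) (c : ℝ) (T : ℕ) :
    MeasurableSet {v | ∃ t ≤ T, c ≤ potential z (Q.iterate fb p x₁ v t)} := by
  have hunion : {v | ∃ t ≤ T, c ≤ potential z (Q.iterate fb p x₁ v t)} =
      ⋃ t ∈ Finset.range (T + 1), {v | c ≤ potential z (Q.iterate fb p x₁ v t)} := by
    ext v
    simp
  rw [hunion]
  exact Finset.measurableSet_biUnion _ fun t _ => measurableSet_le measurable_const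
    ((continuous_potential z).measurable.comp (h.measurable_iterate fb p x₁ t))

namespace BoundedRun

variable {a δ B c y V C p : ℝ} {x₁ z : Vec d} {T : ℕ} (H : Q.BoundedRun fb F G η r R a δ B x₁ z)

local notation "state" => Q.iterate fb (coupledParams r a δ) x₁

include H

theorem fit_le_of_hasRate (hr : HasRate c T y a δ (stepConst N G η R B) V)
    {v : ℕ → UnitSphere d} (hv : ∀ t ≤ T, potential z (state v t) ≤ C) :
    Q.fit fb (coupledParams r a δ) x₁ v T ≤ fitConst N G (N * (2 * C + 1)) c * (T / y) := by
  have hC : 0 ≤ C := (potential_nonneg _ _).trans (hv 0 T.zero_le)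
  exact (H.fit_le fun t ht => sum_dual_le_of_potential_le (hv t ht)).trans
    (hr.fit_bound_le (le_stepConst_add_one N G η R B) H.G_nonneg (by positivity))

variable [NeZero d] {Ω : Type*} [MeasurableSpace Ω] {P : Measure Ω} {u : ℕ → Ω → UnitSphere d}
  {xs : ℕ → Vec d}

theorem integrable_f_action_comp (hu : IsUniformIID P u) (t : ℕ) (m : Fin fb.M) :
    Integrable (fun ω => Q.f t (Q.action fb (coupledParams r a δ) x₁ (fun s => u s ω) t m)) P :=
  integrable_comp_of_hasLaw (X := fun ω s => u s ω) hu.hasLaw_sphereSeq (H.integrable_f_action t m)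

theorem regret_eq (hu : IsUniformIID P u) (xs : ℕ → Vec d) (T : ℕ) :
    Q.regret fb (coupledParams r a δ) x₁ P u xs T =
      Q.regret fb (coupledParams r a δ) x₁ (sphereSeq d) (fun t v => v t) xs T := by
  unfold regret
  congr 2
  exact Finset.sum_congr rfl fun t _ => Finset.sum_congr rfl fun m _ =>
    hu.hasLaw_sphereSeq.integral_comp (H.integrable_f_action t m).aestronglyMeasurable

theorem regret_le_of_hasRate (hu : IsUniformIID P u)
    (hxs : ∀ t, xs t ∈ Q.X ∧ ∀ n, Q.g t (xs t) n ≤ 0)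
    (hr : HasRate c T y a δ (stepConst N G η R B) (variation xs T)) :
    Q.regret fb (coupledParams r a δ) x₁ P u xs T ≤ regretConst F G η r R c * (T / y) := by
  rw [H.regret_eq hu]
  exact (H.regret_le hxs T).trans (hr.regret_bound_le (stepConst_nonneg N G η R B) H.F_nonneg
    H.G_nonneg H.eta_pos H.r_pos H.R_pos)

theorem integrable_fit (T : ℕ) :
    Integrable (fun v => Q.fit fb (coupledParams r a δ) x₁ v T) (sphereSeq d) := by
  refine .of_bound (H.measurable_fit fb _ x₁ T).aestronglyMeasurable (N * (T * (2 * R * G)))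
    (ae_of_all _ fun v => ?_)
  rw [Real.norm_eq_abs, abs_of_nonneg (fit_nonneg _ _ _ _)]
  exact H.fit_le_mul_horizon v T

theorem integral_fit_le (hr : HasRate c T y a δ (stepConst N G η R B) V) (hC : 0 ≤ C)
    (hp : (sphereSeq d).real {v | ∃ t ≤ T, C ≤ potential z (state v t)} ≤ p) :
    ∫ v, Q.fit fb (coupledParams r a δ) x₁ v T ∂sphereSeq d ≤
      fitConst N G (N * (2 * C + 1)) c * (T / y) + N * (T * (2 * R * G)) * p := by
  set A : Set (ℕ → UnitSphere d) := {v | ∃ t ≤ T, C ≤ potential z (state v t)}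
  set b : ℝ := N * (T * (2 * R * G))
  have hR := H.R_pos
  have hG := H.G_nonneg
  have hrate : 0 ≤ fitConst N G (N * (2 * C + 1)) c * (T / y) := by
    have hc := hr.const_pos
    have hy := hr.pos
    unfold fitConst
    positivity
  have hA : MeasurableSet A := H.measurableSet_exists_potential_ge _ x₁ z C T
  have hind : Integrable (A.indicator fun _ => b) (sphereSeq d) :=
    (integrable_const b).indicator hA
  have hle (v : ℕ → UnitSphere d) : Q.fit fb (coupledParams r a δ) x₁ v T ≤
      A.indicator (fun _ => b) v + fitConst N G (N * (2 * C + 1)) c * (T / y) := by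
    by_cases hv : v ∈ A
    · rw [Set.indicator_of_mem hv]
      exact (H.fit_le_mul_horizon v T).trans (le_add_of_nonneg_right hrate)
    · rw [Set.indicator_of_notMem hv, zero_add]
      exact H.fit_le_of_hasRate hr fun t ht => not_lt.1 fun hlt => hv ⟨t, ht, hlt.le⟩
  calc _ ≤ ∫ v, A.indicator (fun _ => b) v ∂sphereSeq d
          + fitConst N G (N * (2 * C + 1)) c * (T / y) :=
        integral_le_integral_add_const (H.integrable_fit T) hind hle
    _ = b * (sphereSeq d).real A + fitConst N G (N * (2 * C + 1)) c * (T / y) := by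
        rw [integral_indicator_const b hA, smul_eq_mul, mul_comm b]
    _ ≤ _ := by
        rw [add_comm]
        gcongr

end BoundedRun

/-! ### High-probability bound under one-point feedback -/

/-- The bound for the potential that holds with high probability under one-point feedback. -/
noncomputable def highProbBound (F G η R : ℝ) : ℝ :=
  ((2 * F + 2 * G + 2) / η) ^ 2 / 2 + 2 * R ^ 2 + 2

theorem highProbBound_nonneg (F G η R : ℝ) : 0 ≤ highProbBound F G η R := by
  unfold highProbBound
  positivity

theorem BoundedRun.measureReal_exists_highProbBound_le [NeZero d] {a δ : ℝ} {x₁ z : Vec d}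
    (H : Q.BoundedRun .one F G η r R a δ (d * F / δ) x₁ z) (hδ : δ ≤ 1)
    (hstep : a * stepConst N G η R (d * F / δ) ≤ 1)
    (hincr : a * (2 * R * (d * F / δ)) + a ^ 2 * stepConst N G η R (d * F / δ) ≤ 1) (T : ℕ) :
    (sphereSeq d).real {v | ∃ t ≤ T, highProbBound F G η R ≤
        potential z (Q.iterate .one (coupledParams r a δ) x₁ v t)} ≤
      (T + 1) ^ 2 * Real.exp (-(δ ^ 2 / (a * (2 * R * (d * F) + 1) ^ 2))) := by
  have hF := H.F_nonneg
  have hR := H.R_pos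
  have hη := H.eta_pos
  have ha := H.a_pos
  have hδ₀ := H.δ_pos
  set w := 2 * R * (d * F) + 1
  have hw₁ : 1 ≤ w := le_add_of_nonneg_left (by positivity)
  have hwB : 2 * R * (d * F / δ) ≤ w / δ := by
    rw [← mul_div_assoc]
    gcongr
    exact le_add_of_nonneg_right zero_le_one
  refine H.measureReal_exists_potential_ge_le (κ := 2 * F + 2 * G + 1)
    (L := (2 * F + 2 * G + 2) / η) (by positivity) ?_ ?_ hincr ?_ T
  · calc δ ^ 2 / (a * w ^ 2) * a * (2 * R * (d * F / δ))
        ≤ δ ^ 2 / (a * w ^ 2) * a * (w / δ) := by gcongr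
      _ = δ / w := by field_simp
      _ ≤ 1 := (div_le_one (one_pos.trans_le hw₁)).2 (hδ.trans hw₁)
  · have hδG : δ * G ≤ G := mul_le_of_le_one_left H.G_nonneg hδ
    have hsq : δ ^ 2 / (a * w ^ 2) * a * (2 * R * (d * F / δ)) ^ 2 ≤ 1 := by
      calc _ ≤ δ ^ 2 / (a * w ^ 2) * a * (w / δ) ^ 2 := by gcongr
        _ = 1 := by field_simp
    linarith
  · rw [mul_div_cancel₀ _ hη.ne']
    linarith

end OnlineProblem

/-! ### Parameters of prescribed order -/

theorem ae_eventually_notMem_of_summable {Ω S : Type*} [MeasurableSpace Ω] [MeasurableSpace S]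
    {P : Measure Ω} {ν : Measure S} [IsFiniteMeasure ν] {X : ℕ → Ω → S}
    (hX : ∀ n, HasLaw (X n) ν P) {A : ℕ → Set S} {b : ℕ → ℝ} (hb : Summable b)
    (hA : ∀ᶠ n in atTop, ν.real (A n) ≤ b n) : ∀ᵐ ω ∂P, ∀ᶠ n in atTop, X n ω ∉ A n := by
  obtain ⟨n₀, hn₀⟩ := eventually_atTop.1 hA
  have hle (n : ℕ) : P (X (n + n₀) ⁻¹' A (n + n₀)) ≤ ENNReal.ofReal (b (n + n₀)) := by
    refine (Measure.le_map_apply (hX _).aemeasurable _).trans ?_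
    rw [(hX _).map_eq, ← ofReal_measureReal]
    exact ENNReal.ofReal_le_ofReal (hn₀ _ (Nat.le_add_left n₀ n))
  have hsum : ∑' n, P (X (n + n₀) ⁻¹' A (n + n₀)) ≠ ⊤ := ne_top_of_le_ne_top
    ((summable_nat_add_iff n₀).2 hb).tsum_ofReal_ne_top (ENNReal.tsum_le_tsum hle)
  filter_upwards [ae_eventually_notMem hsum] with ω hω
  rw [← map_add_atTop_eq_nat n₀]
  exact hω

/-- The bound for the norm of the gradient estimates under the two kinds of feedback. -/
noncomputable def Feedback.gradBound (d : ℕ) (F G δ : ℝ) : Feedback → ℝ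
  | one => d * F / δ
  | two => d * G

theorem Feedback.gradBound_nonneg {d : ℕ} {F G δ : ℝ} (fb : Feedback) (hF : 0 ≤ F) (hG : 0 ≤ G)
    (hδ : 0 < δ) : 0 ≤ fb.gradBound d F G δ := by
  cases fb <;> unfold gradBound <;> positivity

namespace OnlineProblem

/-- A sequence of feasible points whose variation over long horizons `T` is at most `K * T ^ ρ`. -/
structure IsComparator {d N : ℕ} (Q : OnlineProblem d N) (ρ K : ℝ) (xs : ℕ → Vec d) : Prop where
  feasible : ∀ t, xs t ∈ Q.X ∧ ∀ n, Q.g t (xs t) n ≤ 0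
  variation_le : ∀ᶠ T : ℕ in atTop, variation xs T ≤ K * (T : ℝ) ^ ρ

variable {d N : ℕ} {Q : OnlineProblem d N} {fb : Feedback} {F G η r R ρ ε c C K : ℝ}
  {α δ : ℕ → ℝ} {x₁ xs : ℕ → Vec d}

theorem variation_nonneg (xs : ℕ → Vec d) (T : ℕ) : 0 ≤ variation xs T :=
  Finset.sum_nonneg fun _ _ => norm_nonneg _

theorem IsSlotMinimizer.isComparator (hxs : Q.IsSlotMinimizer xs)
    (hV : (fun T : ℕ => variation xs T) =o[atTop] (fun T : ℕ => (T : ℝ) ^ ρ)) :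
    Q.IsComparator ρ 1 xs where
  feasible t := (hxs t).1
  variation_le := by
    filter_upwards [hV.bound one_pos] with T hT
    rwa [Real.norm_of_nonneg (variation_nonneg xs T),
      Real.norm_of_nonneg (Real.rpow_nonneg T.cast_nonneg ρ)] at hT

theorem Regular.norm_gradEst_le (h : Q.Regular F G η r R) (fb : Feedback) {δ : ℝ} (hδ : 0 < δ)
    (hδr : δ ≤ r) (t : ℕ) {x : Vec d} (hx : x ∈ (1 - δ / r) • Q.X) (v : UnitSphere d) :
    ‖fb.gradEst (Q.f t) δ x v‖ ≤ fb.gradBound d F G δ := by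
  cases fb with
  | one => exact h.norm_gradEst_one_le hδ hδr t hx v
  | two => exact h.norm_gradEst_two_le hδ hδr t hx v

theorem Regular.exists_eventually_boundedRun (h : Q.Regular F G η r R) (fb : Feedback)
    (hε : 0 < ε) {K V : ℕ → ℝ}
    (hr : ∀ᶠ T : ℕ in atTop, HasRate c T ((T : ℝ) ^ ε) (α T) (δ T) (K T) (V T))
    (hinit : ∀ᶠ T : ℕ in atTop, x₁ T ∈ (1 - δ T / r) • Q.X) :
    ∃ z, ∀ᶠ T in atTop,
      Q.BoundedRun fb F G η r R (α T) (δ T) (fb.gradBound d F G (δ T)) (x₁ T) z := by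
  obtain ⟨γ, hγ, z, hz, hzg⟩ := h.slater
  refine ⟨z, ?_⟩
  filter_upwards [hr, hinit, eventually_div_rpow_le hε c (mul_pos hγ.1 h.r_pos)] with T hrT hx hc
  have hδ := hrT.δ_pos
  have hδγ : δ T ≤ γ * r := hrT.δ_le.trans hc
  have hδr : δ T ≤ r := hδγ.trans (mul_le_of_le_one_left h.r_pos.le hγ.2.le)
  have hzT : z ∈ (1 - δ T / r) • Q.X := h.smul_subset_smul (sub_nonneg.2 hγ.2.le)
    (sub_le_sub_left ((div_le_iff₀ h.r_pos).2 hδγ) 1) hz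
  exact ⟨h, hrT.a_pos, hδ, hδr, fb.gradBound_nonneg h.F_nonneg h.G_nonneg hδ,
    fun t x hx v => h.norm_gradEst_le fb hδ hδr t hx v, hx, hzT, hzg⟩

section Eventually

variable {z : Vec d} {B V : ℕ → ℝ}
  (hrun : ∀ᶠ T in atTop, Q.BoundedRun fb F G η r R (α T) (δ T) (B T) (x₁ T) z)
include hrun

theorem eventually_regret_le [NeZero d] {Ω : Type*} [MeasurableSpace Ω] {P : Measure Ω}
    {u : ℕ → ℕ → Ω → UnitSphere d} (hu : ∀ T, IsUniformIID P (u T)) (hxs : Q.IsComparator ρ K xs)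
    (hr : ∀ᶠ T : ℕ in atTop, HasRate c T ((T : ℝ) ^ ε) (α T) (δ T)
      (stepConst N G η R (B T)) (variation xs T))
    (hC : regretConst F G η r R c ≤ C) {τ : ℝ} (hτ : τ = 1 - ε) :
    ∀ᶠ T : ℕ in atTop,
      (∀ t < T, ∀ m, Integrable (fun ω => Q.f t (Q.action fb
        (coupledParams r (α T) (δ T)) (x₁ T) (fun s => u T s ω) t m)) P) ∧
      Q.regret fb (coupledParams r (α T) (δ T)) (x₁ T) P (u T) xs T ≤ C * (T : ℝ) ^ τ := by
  filter_upwards [hrun, hr] with T H hr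
  refine ⟨fun t _ m => H.integrable_f_action_comp (hu T) t m, ?_⟩
  have hT := hr.horizon_pos
  rw [hτ, Real.rpow_sub hT, Real.rpow_one]
  exact (H.regret_le_of_hasRate (hu T) hxs.feasible hr).trans (by gcongr)

variable (hr : ∀ᶠ T : ℕ in atTop, HasRate c T ((T : ℝ) ^ ε) (α T) (δ T)
  (stepConst N G η R (B T)) (V T))
include hr

theorem eventually_fit_le {Λ : ℝ} (hC : fitConst N G (N * (2 * Λ + 1)) c ≤ C) {τ : ℝ}
    (hτ : τ = 1 - ε) :
    ∀ᶠ T : ℕ in atTop, ∀ v : ℕ → UnitSphere d,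
      (∀ t ≤ T, potential z (Q.iterate fb (coupledParams r (α T) (δ T)) (x₁ T) v t) ≤ Λ) →
      Q.fit fb (coupledParams r (α T) (δ T)) (x₁ T) v T ≤ C * (T : ℝ) ^ τ := by
  filter_upwards [hrun, hr] with T H hr v hv
  have hT := hr.horizon_pos
  rw [hτ, Real.rpow_sub hT, Real.rpow_one]
  exact (H.fit_le_of_hasRate hr hv).trans (by gcongr)

theorem eventually_integral_fit_le [NeZero d] {Ω : Type*} [MeasurableSpace Ω] {P : Measure Ω}
    {u : ℕ → ℕ → Ω → UnitSphere d} (hu : ∀ T, IsUniformIID P (u T)) {Λ : ℝ} (hΛ : 0 ≤ Λ)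
    (hp : ∀ᶠ T : ℕ in atTop, (sphereSeq d).real {v | ∃ t ≤ T, Λ ≤ potential z
      (Q.iterate fb (coupledParams r (α T) (δ T)) (x₁ T) v t)} ≤ 1 / (T : ℝ) ^ 2)
    (hC : fitConst N G (N * (2 * Λ + 1)) c + N * (2 * R * G) ≤ C) {τ : ℝ} (hτ : τ = 1 - ε) :
    ∀ᶠ T : ℕ in atTop,
      Integrable (fun ω => Q.fit fb (coupledParams r (α T) (δ T)) (x₁ T) (fun s => u T s ω) T) P ∧
      ∫ ω, Q.fit fb (coupledParams r (α T) (δ T)) (x₁ T) (fun s => u T s ω) T ∂P ≤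
        C * (T : ℝ) ^ τ := by
  filter_upwards [hrun, hr, hp, eventually_ge_atTop 1] with T H hr hp hT₁
  refine ⟨integrable_comp_of_hasLaw (X := fun ω s => u T s ω) (hu T).hasLaw_sphereSeq
    (H.integrable_fit T), ?_⟩
  have hT := hr.horizon_pos
  have hbad : N * (T * (2 * R * G)) * (1 / (T : ℝ) ^ 2) ≤
      N * (2 * R * G) * (T / (T : ℝ) ^ ε) := by
    have hb : 0 ≤ N * (2 * R * G) := by
      have hR := H.R_pos
      have hG := H.G_nonneg
      positivity
    calc N * (T * (2 * R * G)) * (1 / (T : ℝ) ^ 2) = N * (2 * R * G) / T := by field_simp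
      _ ≤ N * (2 * R * G) := div_le_self hb (by exact_mod_cast hT₁)
      _ ≤ _ := le_mul_of_one_le_right hb ((one_le_div hr.pos).2 hr.le_horizon)
  rw [hτ, Real.rpow_sub hT, Real.rpow_one]
  calc _ = ∫ v, Q.fit fb (coupledParams r (α T) (δ T)) (x₁ T) v T ∂sphereSeq d :=
        (hu T).hasLaw_sphereSeq.integral_comp (H.integrable_fit T).aestronglyMeasurable
    _ ≤ fitConst N G (N * (2 * Λ + 1)) c * (T / (T : ℝ) ^ ε)
          + N * (2 * R * G) * (T / (T : ℝ) ^ ε) :=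
        (H.integral_fit_le hr hΛ hp).trans (by gcongr)
    _ = (fitConst N G (N * (2 * Λ + 1)) c + N * (2 * R * G)) * (T / (T : ℝ) ^ ε) := by ring
    _ ≤ _ := by gcongr

theorem ae_eventually_fit_le [NeZero d] {Ω : Type*} [MeasurableSpace Ω] {P : Measure Ω}
    {u : ℕ → ℕ → Ω → UnitSphere d} (hu : ∀ T, IsUniformIID P (u T)) {Λ : ℝ}
    (hp : ∀ᶠ T : ℕ in atTop, (sphereSeq d).real {v | ∃ t ≤ T, Λ ≤ potential z
      (Q.iterate fb (coupledParams r (α T) (δ T)) (x₁ T) v t)} ≤ 1 / (T : ℝ) ^ 2)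
    (hC : fitConst N G (N * (2 * Λ + 1)) c ≤ C) {τ : ℝ} (hτ : τ = 1 - ε) :
    ∀ᵐ ω ∂P, ∀ᶠ T : ℕ in atTop, Q.fit fb (coupledParams r (α T) (δ T)) (x₁ T)
      (fun s => u T s ω) T ≤ C * (T : ℝ) ^ τ := by
  filter_upwards [ae_eventually_notMem_of_summable (fun T => (hu T).hasLaw_sphereSeq)
    (Real.summable_one_div_nat_pow.2 one_lt_two) hp] with ω hω
  filter_upwards [eventually_fit_le hrun hr hC hτ, hω] with T hfit hgood
  exact hfit _ fun t ht => not_lt.1 fun hlt => hgood ⟨t, ht, hlt.le⟩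

end Eventually

end OnlineProblem

/-! ### The two feedback regimes -/

namespace OnlineProblem

/-- Step sizes, perturbations and initial points of the order required under one-point
feedback. -/
structure OnePointSchedule {d N : ℕ} (Q : OnlineProblem d N) (r ρ a₁ a₂ b₁ b₂ : ℝ) (α δ : ℕ → ℝ)
    (x₁ : ℕ → Vec d) : Prop where
  step : ∀ᶠ T : ℕ in atTop, a₁ * (T : ℝ) ^ (3 * (ρ - 1) / 4) ≤ α T ∧
    α T ≤ a₂ * (T : ℝ) ^ (3 * (ρ - 1) / 4)
  perturbation : ∀ᶠ T : ℕ in atTop, b₁ * (T : ℝ) ^ ((ρ - 1) / 4) ≤ δ T ∧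
    δ T ≤ b₂ * (T : ℝ) ^ ((ρ - 1) / 4)
  init_mem : ∀ᶠ T : ℕ in atTop, x₁ T ∈ (1 - δ T / r) • Q.X

/-- Step sizes, perturbations and initial points of the order required under two-point
feedback. -/
structure TwoPointSchedule {d N : ℕ} (Q : OnlineProblem d N) (r ρ a₁ a₂ b₂ : ℝ) (α δ : ℕ → ℝ)
    (x₁ : ℕ → Vec d) : Prop where
  step : ∀ᶠ T : ℕ in atTop, a₁ * (T : ℝ) ^ ((ρ - 1) / 2) ≤ α T ∧
    α T ≤ a₂ * (T : ℝ) ^ ((ρ - 1) / 2)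
  perturbation : ∀ᶠ T : ℕ in atTop, 0 < δ T ∧ δ T ≤ b₂ * (T : ℝ) ^ ((ρ - 1) / 2)
  init_mem : ∀ᶠ T : ℕ in atTop, x₁ T ∈ (1 - δ T / r) • Q.X

variable {d N : ℕ} {Q : OnlineProblem d N} {F G η r R ρ a₁ a₂ b₁ b₂ K : ℝ} {α δ : ℕ → ℝ}
  {x₁ xs : ℕ → Vec d} {z : Vec d}

/-- The constant of the rate of one-point feedback; the second-order term comes from gradient
estimates of norm at most `d * F / δ` with `δ` of order `b₁`. -/
noncomputable def onePointRateConst (d N : ℕ) (F G η R a₁ a₂ b₁ b₂ K : ℝ) : ℝ :=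
  rateConst a₁ a₂ b₂ (a₂ * stepConst N G η R (d * F / b₁)) K

/-- The constant of all bounds under one-point feedback. In the second member, the last summand
accounts for the runs along which the potential exceeds its high-probability bound. -/
noncomputable def onePointConst (d N : ℕ) (F G η r R a₁ a₂ b₁ b₂ K : ℝ) : ℝ :=
  let c := onePointRateConst d N F G η R a₁ a₂ b₁ b₂ K
  regretConst F G η r R c ⊔
    (fitConst N G (N * (2 * highProbBound F G η R + 1)) c + N * (2 * R * G))

/-- The constant of the rate of two-point feedback. -/
noncomputable def twoPointRateConst (d N : ℕ) (G η R a₁ a₂ b₂ K : ℝ) : ℝ :=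
  rateConst a₁ a₂ b₂ (a₂ * stepConst N G η R (d * G)) K

/-- The bound for the potential that holds along every run under two-point feedback. -/
noncomputable def sureBound (d : ℕ) (G η R : ℝ) : ℝ :=
  ((2 * R * (d * G) + 1) / η) ^ 2 / 2 + 2 * R ^ 2 + 1

/-- The constant of all bounds under two-point feedback. -/
noncomputable def twoPointConst (d N : ℕ) (F G η r R a₁ a₂ b₂ K : ℝ) : ℝ :=
  let c := twoPointRateConst d N G η R a₁ a₂ b₂ K
  regretConst F G η r R c ⊔ fitConst N G (N * (2 * sureBound d G η R + 1)) c

theorem OnePointSchedule.eventually_hasRate (S : Q.OnePointSchedule r ρ a₁ a₂ b₁ b₂ α δ x₁)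
    (hρ : ρ ∈ Set.Ico (0 : ℝ) 1) (ha₁ : 0 < a₁) (hb₁ : 0 < b₁) (hF : 0 ≤ F)
    (hxs : Q.IsComparator ρ K xs) :
    ∀ᶠ T : ℕ in atTop, HasRate (onePointRateConst d N F G η R a₁ a₂ b₁ b₂ K) T
      ((T : ℝ) ^ ((1 - ρ) / 4)) (α T) (δ T) (stepConst N G η R (d * F / δ T))
      (variation xs T) := by
  filter_upwards [S.step, S.perturbation, hxs.variation_le, eventually_ge_atTop 1]
    with T hα hδ hV hT
  have hT₁ : (1 : ℝ) ≤ T := by exact_mod_cast hT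
  have hT₀ : (0 : ℝ) < T := one_pos.trans_le hT₁
  have hε : 0 ≤ (1 - ρ) / 4 := by linarith [hρ.2]
  have hstep : 3 * (ρ - 1) / 4 = -((3 : ℕ) * ((1 - ρ) / 4)) := by push_cast; ring
  have hpert : (ρ - 1) / 4 = -((1 - ρ) / 4) := by ring
  have hK : α T * stepConst N G η R (d * F / δ T) ≤
      a₂ * stepConst N G η R (d * F / b₁) / (T : ℝ) ^ ((1 - ρ) / 4) := by
    refine mul_stepConst_le_div N G η R (hα.1.trans' (by positivity)) ?_ hb₁
      (Real.one_le_rpow hT₁ hε) ?_ (by positivity)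
    · rw [← mul_one_div, ← rpow_eq_one_div_pow hT₀ 3 hstep]
      exact hα.2
    · rw [← mul_one_div, one_div, ← Real.rpow_neg hT₀.le, ← hpert]
      exact hδ.1
  exact .of_rpow three_ne_zero ha₁ hT₁ hρ.1 hε (by push_cast; ring) hstep hpert hα.1 hα.2
    (hδ.1.trans_lt' (by positivity)) hδ.2 hK (variation_nonneg xs T) hV

theorem eventually_le_one_of_hasRate {ε c : ℝ} {B V : ℕ → ℝ} (hε : 0 < ε) (hR : 0 ≤ R)
    (hr : ∀ᶠ T : ℕ in atTop, HasRate c T ((T : ℝ) ^ ε) (α T) (δ T)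
      (stepConst N G η R (B T)) (V T)) :
    ∀ᶠ T : ℕ in atTop, δ T ≤ 1 ∧ α T * stepConst N G η R (B T) ≤ 1 ∧
      α T * (2 * R * B T) + α T ^ 2 * stepConst N G η R (B T) ≤ 1 := by
  filter_upwards [hr, eventually_div_rpow_le hε c one_pos,
    eventually_div_rpow_le hε ((4 * R + 1) * c) one_pos] with T hr hc hincr
  exact ⟨hr.δ_le.trans hc, hr.step_le.trans hc, hr.potential_increment_le
    (stepConst_nonneg N G η R _) (le_stepConst_add_one N G η R _) hR hincr⟩

theorem OnePointSchedule.eventually_mul_rpow_le (S : Q.OnePointSchedule r ρ a₁ a₂ b₁ b₂ α δ x₁)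
    (ha₁ : 0 < a₁) (hb₁ : 0 < b₁) {w : ℝ} (hw : 0 < w) :
    0 < b₁ ^ 2 / (a₂ * w ^ 2) ∧ ∀ᶠ T : ℕ in atTop,
      b₁ ^ 2 / (a₂ * w ^ 2) * (T : ℝ) ^ ((1 - ρ) / 4) ≤ δ T ^ 2 / (α T * w ^ 2) := by
  have hstep : 3 * (ρ - 1) / 4 = -((3 : ℕ) * ((1 - ρ) / 4)) := by push_cast; ring
  have hpert : (ρ - 1) / 4 = -((1 : ℕ) * ((1 - ρ) / 4)) := by push_cast; ring
  have ha₂ : 0 < a₂ := by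
    obtain ⟨T, hα, hT⟩ := (S.step.and (eventually_gt_atTop 0)).exists
    have hpow : 0 < (T : ℝ) ^ (3 * (ρ - 1) / 4) := Real.rpow_pos_of_pos (by exact_mod_cast hT) _
    exact ha₁.trans_le (le_of_mul_le_mul_right (hα.1.trans hα.2) hpow)
  refine ⟨by positivity, ?_⟩
  filter_upwards [S.step, S.perturbation, eventually_gt_atTop 0] with T hα hδ hT
  have hT₀ : (0 : ℝ) < T := by exact_mod_cast hT
  have hα₀ : 0 < α T := hα.1.trans_lt' (by positivity)
  rw [rpow_eq_one_div_pow hT₀ 3 hstep] at hα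
  rw [rpow_eq_one_div_pow hT₀ 1 hpert, pow_one] at hδ
  set y : ℝ := (T : ℝ) ^ ((1 - ρ) / 4)
  have hy : 0 < y := Real.rpow_pos_of_pos hT₀ _
  calc b₁ ^ 2 / (a₂ * w ^ 2) * y
      = (b₁ * (1 / y)) ^ 2 / (a₂ * (1 / y ^ 3) * w ^ 2) := by field_simp
    _ ≤ δ T ^ 2 / (α T * w ^ 2) := by
        gcongr
        exacts [hδ.1, hα.2]

theorem OnePointSchedule.eventually_measureReal_le [NeZero d]
    (S : Q.OnePointSchedule r ρ a₁ a₂ b₁ b₂ α δ x₁) (hρ : ρ < 1) (ha₁ : 0 < a₁) (hb₁ : 0 < b₁)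
    {c : ℝ} {V : ℕ → ℝ}
    (hrun : ∀ᶠ T in atTop, Q.BoundedRun .one F G η r R (α T) (δ T) (d * F / δ T) (x₁ T) z)
    (hr : ∀ᶠ T : ℕ in atTop, HasRate c T ((T : ℝ) ^ ((1 - ρ) / 4)) (α T) (δ T)
      (stepConst N G η R (d * F / δ T)) (V T)) :
    ∀ᶠ T : ℕ in atTop, (sphereSeq d).real {v | ∃ t ≤ T, highProbBound F G η R ≤
      potential z (Q.iterate .one (coupledParams r (α T) (δ T)) (x₁ T) v t)} ≤
        1 / (T : ℝ) ^ 2 := by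
  have hε : 0 < (1 - ρ) / 4 := by linarith
  obtain ⟨T₀, H₀⟩ := hrun.exists
  have hF := H₀.F_nonneg
  have hR := H₀.R_pos
  obtain ⟨hκ, hθ⟩ := S.eventually_mul_rpow_le ha₁ hb₁
    (w := 2 * R * (d * F) + 1) (by positivity)
  filter_upwards [hrun, eventually_le_one_of_hasRate hε hR.le hr, hθ,
    eventually_sq_mul_exp_le hε hκ] with T H hsmall hθ hexp
  refine (H.measureReal_exists_highProbBound_le hsmall.1 hsmall.2.1 hsmall.2.2 T).trans
    (hexp.trans' ?_)
  gcongr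

theorem TwoPointSchedule.eventually_hasRate (S : Q.TwoPointSchedule r ρ a₁ a₂ b₂ α δ x₁)
    (hρ : ρ ∈ Set.Ico (0 : ℝ) 1) (ha₁ : 0 < a₁) (hxs : Q.IsComparator ρ K xs) :
    ∀ᶠ T : ℕ in atTop, HasRate (twoPointRateConst d N G η R a₁ a₂ b₂ K) T
      ((T : ℝ) ^ ((1 - ρ) / 2)) (α T) (δ T) (stepConst N G η R (d * G)) (variation xs T) := by
  filter_upwards [S.step, S.perturbation, hxs.variation_le, eventually_ge_atTop 1]
    with T hα hδ hV hT
  have hT₁ : (1 : ℝ) ≤ T := by exact_mod_cast hT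
  have hstep : (ρ - 1) / 2 = -((1 : ℕ) * ((1 - ρ) / 2)) := by push_cast; ring
  have hK : α T * stepConst N G η R (d * G) ≤
      a₂ * stepConst N G η R (d * G) / (T : ℝ) ^ ((1 - ρ) / 2) := by
    rw [mul_div_right_comm]
    refine mul_le_mul_of_nonneg_right ?_ (stepConst_nonneg N G η R _)
    refine hα.2.trans_eq ?_
    rw [rpow_eq_one_div_pow (one_pos.trans_le hT₁) 1 hstep, pow_one, mul_one_div]
  exact .of_rpow one_ne_zero ha₁ hT₁ hρ.1 (by linarith [hρ.2]) (by push_cast; ring) hstep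
    (by ring) hα.1 hα.2 hδ.1 hδ.2 hK (variation_nonneg xs T) hV

theorem eventually_potential_le_sureBound {ε c : ℝ} {V : ℕ → ℝ} (hε : 0 < ε)
    (hrun : ∀ᶠ T in atTop, Q.BoundedRun .two F G η r R (α T) (δ T) (d * G) (x₁ T) z)
    (hr : ∀ᶠ T : ℕ in atTop, HasRate c T ((T : ℝ) ^ ε) (α T) (δ T)
      (stepConst N G η R (d * G)) (V T)) :
    ∀ᶠ T in atTop, ∀ (v : ℕ → UnitSphere d) (t : ℕ),
      potential z (Q.iterate .two (coupledParams r (α T) (δ T)) (x₁ T) v t) ≤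
        sureBound d G η R := by
  obtain ⟨T₀, H₀⟩ := hrun.exists
  filter_upwards [hrun, eventually_le_one_of_hasRate hε H₀.R_pos.le hr] with T H hsmall v t
  refine H.potential_slater_le_of_drift hsmall.2.2 ?_ v t
  rw [mul_div_cancel₀ _ H.eta_pos.ne']
  linarith [hsmall.2.1]

end OnlineProblem

open OnlineProblem in
theorem corollary1_general (d N : ℕ) [NeZero d] (F G η r R ρ K : ℝ)
    (hρ : ρ ∈ Set.Ico (0 : ℝ) 1) (a₁ a₂ b₁ b₂ : ℝ) (ha₁ : 0 < a₁) (hb₁ : 0 < b₁) :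
    (∃ C : ℝ, ∀ Q : OnlineProblem d N, Q.Regular F G η r R →
      ∀ xs : ℕ → Vec d, Q.IsComparator ρ K xs →
      ∀ (α δ : ℕ → ℝ) (x₁ : ℕ → Vec d), Q.OnePointSchedule r ρ a₁ a₂ b₁ b₂ α δ x₁ →
      ∀ (Ω : Type*) [MeasurableSpace Ω] (P : Measure Ω) (u : ℕ → ℕ → Ω → UnitSphere d),
      (∀ T, IsUniformIID P (u T)) →
      (∀ᶠ T : ℕ in atTop,
        (∀ t < T, ∀ m, Integrable (fun ω => Q.f t (Q.action Feedback.one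
          (coupledParams r (α T) (δ T)) (x₁ T) (fun s => u T s ω) t m)) P) ∧
        Q.regret Feedback.one (coupledParams r (α T) (δ T)) (x₁ T) P (u T) xs T
          ≤ C * (T : ℝ) ^ ((ρ + 3) / 4)) ∧
      (∀ᵐ ω ∂P, ∀ᶠ T : ℕ in atTop,
        Q.fit Feedback.one (coupledParams r (α T) (δ T)) (x₁ T) (fun s => u T s ω) T
          ≤ C * (T : ℝ) ^ ((ρ + 3) / 4)) ∧
      (∀ᶠ T : ℕ in atTop,
        Integrable (fun ω => Q.fit Feedback.one (coupledParams r (α T) (δ T)) (x₁ T)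
          (fun s => u T s ω) T) P ∧
        ∫ ω, Q.fit Feedback.one (coupledParams r (α T) (δ T)) (x₁ T) (fun s => u T s ω) T ∂P
          ≤ C * (T : ℝ) ^ ((ρ + 3) / 4))) ∧
    (∃ C : ℝ, ∀ Q : OnlineProblem d N, Q.Regular F G η r R →
      ∀ xs : ℕ → Vec d, Q.IsComparator ρ K xs →
      ∀ (α δ : ℕ → ℝ) (x₁ : ℕ → Vec d), Q.TwoPointSchedule r ρ a₁ a₂ b₂ α δ x₁ →
      ∀ (Ω : Type*) [MeasurableSpace Ω] (P : Measure Ω) (u : ℕ → ℕ → Ω → UnitSphere d),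
      (∀ T, IsUniformIID P (u T)) →
      (∀ᶠ T : ℕ in atTop,
        (∀ t < T, ∀ m, Integrable (fun ω => Q.f t (Q.action Feedback.two
          (coupledParams r (α T) (δ T)) (x₁ T) (fun s => u T s ω) t m)) P) ∧
        Q.regret Feedback.two (coupledParams r (α T) (δ T)) (x₁ T) P (u T) xs T
          ≤ C * (T : ℝ) ^ ((ρ + 1) / 2)) ∧
      (∀ᶠ T : ℕ in atTop, ∀ v : ℕ → UnitSphere d,
        Q.fit Feedback.two (coupledParams r (α T) (δ T)) (x₁ T) v T
          ≤ C * (T : ℝ) ^ ((ρ + 1) / 2))) := by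
  refine ⟨⟨onePointConst d N F G η r R a₁ a₂ b₁ b₂ K,
      fun Q h xs hxs α δ x₁ S Ω _ P u hu => ?_⟩,
    ⟨twoPointConst d N F G η r R a₁ a₂ b₂ K,
      fun Q h xs hxs α δ x₁ S Ω _ P u hu => ?_⟩⟩
  · have hε : 0 < (1 - ρ) / 4 := by linarith [hρ.2]
    have hτ : (ρ + 3) / 4 = 1 - (1 - ρ) / 4 := by ring
    have hr := S.eventually_hasRate (G := G) (η := η) (R := R) hρ ha₁ hb₁ h.F_nonneg hxs
    obtain ⟨z, hrun⟩ := h.exists_eventually_boundedRun .one hε hr S.init_mem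
    have hp := S.eventually_measureReal_le hρ.2 ha₁ hb₁ hrun hr
    have hN : 0 ≤ N * (2 * R * G) :=
      mul_nonneg N.cast_nonneg (mul_nonneg (mul_nonneg zero_le_two h.R_pos.le) h.G_nonneg)
    exact ⟨eventually_regret_le hrun hu hxs hr le_sup_left hτ,
      ae_eventually_fit_le hrun hr hu hp
        ((le_add_of_nonneg_right hN).trans le_sup_right) hτ,
      eventually_integral_fit_le hrun hr hu (highProbBound_nonneg F G η R) hp
        le_sup_right hτ⟩
  · have hε : 0 < (1 - ρ) / 2 := by linarith [hρ.2]
    have hτ : (ρ + 1) / 2 = 1 - (1 - ρ) / 2 := by ring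
    have hr := S.eventually_hasRate (G := G) (η := η) (R := R) hρ ha₁ hxs
    obtain ⟨z, hrun⟩ := h.exists_eventually_boundedRun .two (F := F) hε hr S.init_mem
    refine ⟨eventually_regret_le hrun hu hxs hr le_sup_left hτ, ?_⟩
    filter_upwards [eventually_fit_le hrun hr le_sup_right hτ,
      eventually_potential_le_sureBound hε hrun hr] with T hfit hpot v
    exact hfit v fun t _ => hpot v t

theorem corollary1 (d N : ℕ) (hd : 0 < d) (F G η r R ρ : ℝ) (hρ : ρ ∈ Set.Ico (0 : ℝ) 1)
    (a₁ a₂ b₁ b₂ : ℝ) (ha₁ : 0 < a₁) (hb₁ : 0 < b₁) :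
    -- one-point feedback
    (∃ C : ℝ, ∀ (Q : OnlineProblem d N), Q.Regular F G η r R →
      ∀ (xs : ℕ → Vec d), Q.IsSlotMinimizer xs →
      (fun T : ℕ => variation xs T) =o[atTop] (fun T : ℕ => (T : ℝ) ^ ρ) →
      ∀ (α δ : ℕ → ℝ) (x₁ : ℕ → Vec d),
      (∀ᶠ T : ℕ in atTop, a₁ * (T : ℝ) ^ (3 * (ρ - 1) / 4) ≤ α T ∧
        α T ≤ a₂ * (T : ℝ) ^ (3 * (ρ - 1) / 4)) →
      (∀ᶠ T : ℕ in atTop, b₁ * (T : ℝ) ^ ((ρ - 1) / 4) ≤ δ T ∧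
        δ T ≤ b₂ * (T : ℝ) ^ ((ρ - 1) / 4)) →
      (∀ᶠ T : ℕ in atTop, x₁ T ∈ (1 - δ T / r) • Q.X) →
      ∀ (Ω : Type*) [MeasurableSpace Ω] (P : Measure Ω) [IsProbabilityMeasure P]
        (u : ℕ → ℕ → Ω → UnitSphere d), (∀ T, IsUniformIID P (u T)) →
      -- dynamic regret
      (∀ᶠ T : ℕ in atTop,
        (∀ t < T, ∀ m, Integrable (fun ω => Q.f t (Q.action Feedback.one
          (coupledParams r (α T) (δ T)) (x₁ T) (fun s => u T s ω) t m)) P) ∧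
        Q.regret Feedback.one (coupledParams r (α T) (δ T)) (x₁ T) P (u T) xs T
          ≤ C * (T : ℝ) ^ ((ρ + 3) / 4)) ∧
      -- dynamic fit, almost surely and in expectation
      (∀ᵐ ω ∂P, ∀ᶠ T : ℕ in atTop,
        Q.fit Feedback.one (coupledParams r (α T) (δ T)) (x₁ T) (fun s => u T s ω) T
          ≤ C * (T : ℝ) ^ ((ρ + 3) / 4)) ∧
      (∀ᶠ T : ℕ in atTop,
        Integrable (fun ω => Q.fit Feedback.one (coupledParams r (α T) (δ T)) (x₁ T)
          (fun s => u T s ω) T) P ∧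
        ∫ ω, Q.fit Feedback.one (coupledParams r (α T) (δ T)) (x₁ T) (fun s => u T s ω) T ∂P
          ≤ C * (T : ℝ) ^ ((ρ + 3) / 4))) ∧
    -- two-point feedback
    (∃ C : ℝ, ∀ (Q : OnlineProblem d N), Q.Regular F G η r R →
      ∀ (xs : ℕ → Vec d), Q.IsSlotMinimizer xs →
      (fun T : ℕ => variation xs T) =o[atTop] (fun T : ℕ => (T : ℝ) ^ ρ) →
      ∀ (α δ : ℕ → ℝ) (x₁ : ℕ → Vec d),
      (∀ᶠ T : ℕ in atTop, a₁ * (T : ℝ) ^ ((ρ - 1) / 2) ≤ α T ∧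
        α T ≤ a₂ * (T : ℝ) ^ ((ρ - 1) / 2)) →
      (∀ᶠ T : ℕ in atTop, 0 < δ T ∧ δ T ≤ b₂ * (T : ℝ) ^ ((ρ - 1) / 2)) →
      (∀ᶠ T : ℕ in atTop, x₁ T ∈ (1 - δ T / r) • Q.X) →
      ∀ (Ω : Type*) [MeasurableSpace Ω] (P : Measure Ω) [IsProbabilityMeasure P]
        (u : ℕ → ℕ → Ω → UnitSphere d), (∀ T, IsUniformIID P (u T)) →
      -- dynamic regret
      (∀ᶠ T : ℕ in atTop,
        (∀ t < T, ∀ m, Integrable (fun ω => Q.f t (Q.action Feedback.two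
          (coupledParams r (α T) (δ T)) (x₁ T) (fun s => u T s ω) t m)) P) ∧
        Q.regret Feedback.two (coupledParams r (α T) (δ T)) (x₁ T) P (u T) xs T
          ≤ C * (T : ℝ) ^ ((ρ + 1) / 2)) ∧
      -- dynamic fit, almost surely with a non-random threshold on the horizon
      (∀ᶠ T : ℕ in atTop, ∀ᵐ ω ∂P,
        Q.fit Feedback.two (coupledParams r (α T) (δ T)) (x₁ T) (fun s => u T s ω) T
          ≤ C * (T : ℝ) ^ ((ρ + 1) / 2))) := by
  have : NeZero d := ⟨hd.ne'⟩
  obtain ⟨⟨C₁, h₁⟩, ⟨C₂, h₂⟩⟩ := corollary1_general d N F G η r R ρ 1 hρ a₁ a₂ b₁ b₂ ha₁ hb₁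
  refine ⟨⟨C₁, fun Q h xs hxs hV α δ x₁ hα hδ hx Ω _ P _ u hu =>
    h₁ Q h xs (hxs.isComparator hV) α δ x₁ ⟨hα, hδ, hx⟩ Ω P u hu⟩,
    ⟨C₂, fun Q h xs hxs hV α δ x₁ hα hδ hx Ω _ P _ u hu => ?_⟩⟩
  obtain ⟨hregret, hfit⟩ := h₂ Q h xs (hxs.isComparator hV) α δ x₁ ⟨hα, hδ, hx⟩ Ω P u hu
  exact ⟨hregret, hfit.mono fun T hT => ae_of_all P fun ω => hT fun s => u T s ω⟩
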